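/- **Setting.** Let $k\ge 1$, $n\ge 0$ be integers and $\gamma\ge e^k k^2$ real; put $\delta=\tfrac1{200}$, $\eta=(1/\gamma^2)^{2/\delta}$, $1/\tau=4\log_2(\gamma k^2)$. A $(k,n)$-instance $\mathcal I$ is a $k$-uniform hypergraph on $[n]$ whose hyperedges (clauses) are ordered tuples $C=(i_1,\dots,i_k)$ of distinct vertices, with pairwise distinct vertex sets $V(C)$, each labelled by signs $\sigma^C\in\{\pm1\}^k$. A path of length $\ell$ is a sequence of distinct clauses $C_1,\dots,C_\ell$ with $V(C_i)\cap V(C_{i+1})\ne\emptyset$ and $V(C_i)\cap V(C_j)=\emptyset$ for $|i-j|>1$; it is a path between $v\neq v'$ if $v$ lies in $C_1$ and in no other $C_i$, and $v'$ lies in $C_\ell$ and in no other $C_i$. A cycle of length $\ell\ge2$ consists of distinct clauses $C_0,\dots,C_{\ell-1}$ and distinct vertices $v_i\in V(C_i)\cap V(C_{(i+1)\bmod \ell})$. Call $\mathcal I$ *nice* (with parameter $\gamma$) if every collection of $t\le\eta n$ clauses covers at least $(k-1-\delta)t$ vertices and every cycle has length at least $\tau\log_2 n$. A set $A\subseteq[n]$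 is closed if it contains all vertices of every path of length at most $3$ between two distinct vertices of $A$; $\mathsf{cl}(S)$ is the intersection of all closed sets containing $S$, and $\mathcal C(A)$ is the set of clauses $C$ with $V(C)\subseteq A$. Let $\mu$ be a pairwise independent distribution on $\{\pm1\}^k$ (every marginal on two distinct coordinates is uniform on $\{\pm1\}^2$). For closed $A$ and $x\in\{\pm1\}^A$ put $$\nu_A(x)=2^{k|\mathcal C(A)|-|A|}\prod_{C=(i_1,\dots,i_k)\in\mathcal C(A)}\mu(\sigma^C_1x_{i_1},\dots,\sigma^C_kx_{i_k}),$$ and for arbitrary $S$ let $\nu_S$ be the marginal of $\nu_{\mathsf{cl}(S)}$ on $S$. With $\chi_S=\prod_{i\in S}x_i$, let $\tilde{\mathbb E}$ be the linear operator with $\tilde{\mathbb E}[\chi_S]=\sum_{y\in\{\pm1\}^S}\nu_S(y)\prod_{i\in S}y_i$, extended to all polynomials by reducing modulo the relations $x_i^2=1$. **Lemma.** Let $\mathcal I$ be a nice $(k,n)$-instance with parameter $\gamma$, $\mu$ a pairwise independent distribution on $\{\pm1\}^k$, $d=\frac{\eta n}{10000k}$, and let $P_d^n=\mathrm{Span}\{\chi_A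 : |A|\le d\}$ be the space of real multilinear polynomials in $x_1,\dots,x_n$ of degree at most $d$. There are polynomials $\tilde\chi_0,\dots,\tilde\chi_M$, where $M+1=\binom{n}{\le d}=\sum_{j\le d}\binom nj$, such that 1. $P_d^n=\mathrm{Span}\{\tilde\chi_i : 0\le i\le M\}$; 2. $\tilde{\mathbb E}[\tilde\chi_i^2]\ge0$ for all $i$; 3. $\tilde{\mathbb E}[\tilde\chi_i\tilde\chi_j]=0$ whenever $i\ne j$. Consequently $\tilde{\mathbb E}[f^2]\ge0$ for every $f\in P_d^n$. -/

import Mathlib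

noncomputable section

/-- A `(k,n)`-instance: a `k`-uniform hypergraph on the variables `Fin n` with `m` hyperedges
(clauses), pairwise distinct as vertex sets. The clause `c` is the ordered tuple `var c` of `k`
distinct variables, labelled by the sign string `sgn c`. The signs `±1` are the units of `ℤ`. -/
structure CSPInstance (k n : ℕ) where
  m : ℕ
  var : Fin m → (Fin k ↪ Fin n)
  sgn : Fin m → (Fin k → ℤˣ)
  distinct : Function.Injective fun c => (Finset.univ.map (var c) : Finset (Fin n))

/-- All two-coordinate marginals of `μ` are uniform on `{±1}²`. -/
def PairwiseIndependent {k : ℕ} (μ : PMF (Fin k → ℤˣ)) : Prop :=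
  ∀ i j : Fin k, i ≠ j → μ.map (fun y => (y i, y j)) = PMF.uniformOfFintype (ℤˣ × ℤˣ)

/-- The expansion coefficient of nice instances. -/
def expansionDelta : ℝ := 1 / 200

/-- `η = (1/γ²)^(2/δ)`. -/
def sosEta (γ : ℝ) : ℝ := (1 / γ ^ 2) ^ (2 / expansionDelta)

/-- `1/τ = 4 log₂(γ k²)`. -/
def girthTau (k : ℕ) (γ : ℝ) : ℝ := 1 / (4 * Real.logb 2 (γ * (k : ℝ) ^ 2))

/-- `d = η n / (10000 k)`. -/
def sosDegree (k n : ℕ) (γ : ℝ) : ℝ := sosEta γ * n / (10000 * k)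

namespace CSPInstance

variable {k n : ℕ} (I : CSPInstance k n)

/-- `V(C)`: the variables covered by the clause `c`. -/
def verts (c : Fin I.m) : Finset (Fin n) := Finset.univ.map (I.var c)

/-- `𝒞(A)`: the clauses all of whose variables lie in `A`. -/
def clausesIn (A : Finset (Fin n)) : Finset (Fin I.m) :=
  Finset.univ.filter fun c => I.verts c ⊆ A

theorem var_mem_of_mem_clausesIn {A : Finset (Fin n)} {c : Fin I.m} (hc : c ∈ I.clausesIn A)
    (j : Fin k) : I.var c j ∈ A :=
  (Finset.mem_filter.mp hc).2 (Finset.mem_map_of_mem _ (Finset.mem_univ j))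

/-- Every collection of at most `r` hyperedges covers at least `k - 1 - β` vertices per
hyperedge. -/
def Expanding (r β : ℝ) : Prop :=
  ∀ F : Finset (Fin I.m), (F.card : ℝ) ≤ r →
    ((k : ℝ) - 1 - β) * F.card ≤ ((F.biUnion I.verts).card : ℝ)

/-- A cycle of length `ℓ ≥ 2`: distinct hyperedges `p 0, …, p (ℓ-1)` in cyclic order with
distinct vertices `v i ∈ p i ∩ p (i+1 mod ℓ)`. -/
def IsCycle {ℓ : ℕ} (p : Fin ℓ → Fin I.m) : Prop :=
  2 ≤ ℓ ∧ Function.Injective p ∧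
    ∃ v : Fin ℓ → Fin n, Function.Injective v ∧
      ∀ i, v i ∈ I.verts (p i) ∧ v i ∈ I.verts (p (finRotate ℓ i))

/-- The girth is at least `g` (it is infinite if there are no cycles). -/
def GirthAtLeast (g : ℝ) : Prop :=
  ∀ (ℓ : ℕ) (p : Fin ℓ → Fin I.m), I.IsCycle p → g ≤ ℓ

/-- Nice instances with parameter `γ`: `(ηn, δ)`-expanding and of girth at least `τ log₂ n`. -/
def IsNice (γ : ℝ) : Prop :=
  I.Expanding (sosEta γ * n) expansionDelta ∧ I.GirthAtLeast (girthTau k γ * Real.logb 2 n)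

/-- A path of length `ℓ`: distinct hyperedges in a sequence, consecutive ones intersecting and
non-consecutive ones disjoint. -/
def IsPath {ℓ : ℕ} (p : Fin ℓ → Fin I.m) : Prop :=
  Function.Injective p ∧
    (∀ i j : Fin ℓ, (i : ℕ) + 1 = j → (I.verts (p i) ∩ I.verts (p j)).Nonempty) ∧
    (∀ i j : Fin ℓ, (i : ℕ) + 1 < j → Disjoint (I.verts (p i)) (I.verts (p j)))

/-- `p` is a path between the distinct vertices `v` and `v'`: `v` lies in its first hyperedge
and `v'` in its last one, and in no other hyperedge of the path (a hyperedge that is merely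
attached to `v` or `v'` is not part of a path between them). -/
def IsPathBetween (v v' : Fin n) {ℓ : ℕ} (p : Fin ℓ → Fin I.m) : Prop :=
  0 < ℓ ∧ v ≠ v' ∧ I.IsPath p ∧
    (∀ i : Fin ℓ, v ∈ I.verts (p i) ↔ (i : ℕ) = 0) ∧
    (∀ i : Fin ℓ, v' ∈ I.verts (p i) ↔ (i : ℕ) + 1 = ℓ)

/-- `A` is `R`-closed: every path of length at most `R` between two vertices of `A` is
contained in `A`. -/
def IsRClosed (R : ℕ) (A : Finset (Fin n)) : Prop :=
  ∀ v ∈ A, ∀ v' ∈ A, ∀ ℓ : ℕ, ℓ ≤ R → ∀ p : Fin ℓ → Fin I.m,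
    I.IsPathBetween v v' p → ∀ i, I.verts (p i) ⊆ A

open Classical in
/-- `cl_R(A)`: the intersection of all `R`-closed sets containing `A`. -/
def rClosure (R : ℕ) (A : Finset (Fin n)) : Finset (Fin n) :=
  Finset.univ.filter fun v => ∀ B : Finset (Fin n), A ⊆ B → I.IsRClosed R B → v ∈ B

/-- The closure is the `3`-closure. -/
def cl (A : Finset (Fin n)) : Finset (Fin n) := I.rClosure 3 A

theorem subset_cl (A : Finset (Fin n)) : A ⊆ I.cl A := by
  classical
  intro v hv
  simp only [cl, rClosure, Finset.mem_filter, Finset.mem_univ, true_and]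
  exact fun B hB _ => hB hv

/-- For a closed set `A`, the local distribution
`ν_A(x) = 2^(k|𝒞(A)| - |A|) ∏_{C ∈ 𝒞(A)} μ_C(x_C)` on `{±1}^A`, where
`μ_C(x_C) = μ(σ₁ x_{i₁}, …, σ_k x_{i_k})`. -/
def nuClosed (μ : PMF (Fin k → ℤˣ)) (A : Finset (Fin n)) (x : A → ℤˣ) : ℝ :=
  (2 : ℝ) ^ ((k : ℤ) * ((I.clausesIn A).card : ℤ) - (A.card : ℤ)) *
    ∏ c ∈ (I.clausesIn A).attach,
      (μ fun j => I.sgn c.1 j * x ⟨I.var c.1 j, I.var_mem_of_mem_clausesIn c.2 j⟩).toReal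

/-- `ν_T`: the marginal on `T` of the local distribution on `cl(T)`. -/
def nuMarginal (μ : PMF (Fin k → ℤˣ)) (T : Finset (Fin n)) (y : T → ℤˣ) : ℝ :=
  ∑ x : (I.cl T → ℤˣ) with (fun i : T => x ⟨i.1, I.subset_cl T i.2⟩) = y,
    I.nuClosed μ (I.cl T) x

/-- `𝔼_{ν_S}[χ_S]`. -/
def charExpectation (μ : PMF (Fin k → ℤˣ)) (S : Finset (Fin n)) : ℝ :=
  ∑ y : S → ℤˣ, I.nuMarginal μ S y * ∏ i, (((y i : ℤˣ) : ℤ) : ℝ)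

/-- The operator `Ẽ`: linear, `Ẽ[χ_S] = 𝔼_{ν_S}[χ_S]`, with polynomials reduced to
multilinear ones by the relations `x_i² = 1` (a monomial is replaced by the product of the
variables of odd exponent). The formula is used for all sets `S`, but only
the values of `Ẽ` on polynomials of degree at most `η n / 6` are meaningful. -/
def pE (μ : PMF (Fin k → ℤˣ)) : MvPolynomial (Fin n) ℝ →ₗ[ℝ] ℝ :=
  (MvPolynomial.basisMonomials (Fin n) ℝ).constr ℝ fun e : Fin n →₀ ℕ =>
    I.charExpectation μ (Finset.univ.filter fun i => Odd (e i))

end CSPInstance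

/-- The character `χ_S = ∏_{i ∈ S} x_i`. -/
def character {n : ℕ} (S : Finset (Fin n)) : MvPolynomial (Fin n) ℝ :=
  ∏ i ∈ S, MvPolynomial.X i

/-- `P_d^n = Span {χ_A : |A| ≤ d}`: the multilinear polynomials of degree at most `d`. -/
def multilinearPolys (n : ℕ) (d : ℝ) : Submodule ℝ (MvPolynomial (Fin n) ℝ) :=
  Submodule.span ℝ {p | ∃ A : Finset (Fin n), (A.card : ℝ) ≤ d ∧ p = character A}

end

/-! Gram–Schmidt is run on the characters, listed by increasing size, but locally: `χ_S` is
projected only against the earlier `χ_B` with `B` inside the 5-closure `V` of `S`. On functions of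
`V` the operator `pE` is integration against a nonnegative density, so the projection `g` exists and
its square has nonnegative value. The point is that `g` is also orthogonal to every earlier `χ_T`
with `T ⊄ V`. Over the 5-closure of `S ∪ T`, expand `χ_T` times the density of the clauses outside
`V` in characters. Only `χ_B` with `B ⊆ V` matter, and a nonzero coefficient forces `|B| < |T| ≤
|S|` (`Expanding.card_lt_of_expect_ne_zero`). So `B` precedes `S`, and `g` is orthogonal to `χ_B` by
construction.

The size inequality comes from cores. By pairwise independence, a clause with at most two vertices
in the character or in other clauses integrates out. What remains is a core `F`, each of whose
clauses has three boundary vertices; expansion gives `99|F| ≤ 100|S ∩ V(F)|`, where `S` is now the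
support of the character. Closedness and girth give each vertex of the closed set that lies in the
core a private neighbourhood, disjoint from the others, and counting these contradicts the bound on
`|F|` unless most boundary vertices lie outside. The same count for 3-closed sets leaves no core at
all, so local expectations are consistent. Expansion also keeps closures of small sets small.

Unary clauses and degree bounds below 1 are handled directly. -/

/-! ### Fourier analysis on the cube -/

/-- The character `∏_{i ∈ S} x_i` as a function on the cube `{±1}^ι`. -/
noncomputable def signChar {ι : Type*} (S : Finset ι) (x : ι → ℤˣ) : ℝ :=
  ∏ i ∈ S, (((x i : ℤˣ) : ℤ) : ℝ)

/-- Flip the sign of the coordinate `v`. -/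
def flipSign {ι : Type*} [DecidableEq ι] (v : ι) (x : ι → ℤˣ) : ι → ℤˣ :=
  Function.update x v (-x v)

theorem unit_cast_mul_self (u : ℤˣ) : ((u : ℤ) : ℝ) * ((u : ℤ) : ℝ) = 1 := by
  rcases Int.units_eq_one_or u with h | h <;> simp [h]

/-- The sum is the expansion of `∏ (x_i y_i + 1)`, which has a zero factor as soon as `x` and `y`
differ somewhere. -/
theorem sum_signChar_mul_signChar {ι : Type*} [Fintype ι] [DecidableEq (ι → ℤˣ)] (x y : ι → ℤˣ) :
    ∑ T : Finset ι, signChar T x * signChar T y = if x = y then 2 ^ Fintype.card ι else 0 := by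
  classical
  have h1 : ∑ T : Finset ι, signChar T x * signChar T y =
      ∏ i, ((((x i : ℤˣ) : ℤ) : ℝ) * (((y i : ℤˣ) : ℤ) : ℝ) + 1) := by
    rw [Finset.prod_add_one, Finset.powerset_univ]
    exact Finset.sum_congr rfl fun T _ => Finset.prod_mul_distrib.symm
  rw [h1]
  split_ifs with h
  · subst h
    simp only [unit_cast_mul_self]
    norm_num
  · obtain ⟨i, hi⟩ := Function.ne_iff.mp h
    refine Finset.prod_eq_zero (Finset.mem_univ i) ?_
    rcases Int.units_eq_one_or (x i) with hx | hx <;>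
      rcases Int.units_eq_one_or (y i) with hy | hy <;> simp_all

section Cube

variable {ι : Type*} [DecidableEq ι]

theorem signChar_mul (S T : Finset ι) (x : ι → ℤˣ) :
    signChar S x * signChar T x = signChar (symmDiff S T) x := by
  have hS : signChar S x = signChar (S \ T) x * signChar (S ∩ T) x := by
    unfold signChar
    rw [← Finset.prod_union (Finset.disjoint_sdiff_inter S T), Finset.sdiff_union_inter]
  have hT : signChar T x = signChar (T \ S) x * signChar (S ∩ T) x := by
    unfold signChar
    rw [Finset.inter_comm, ← Finset.prod_union (Finset.disjoint_sdiff_inter T S),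
      Finset.sdiff_union_inter]
  have hI : signChar (S ∩ T) x * signChar (S ∩ T) x = 1 := by
    unfold signChar
    rw [← Finset.prod_mul_distrib]
    exact Finset.prod_eq_one fun i _ => unit_cast_mul_self _
  have hD : signChar (symmDiff S T) x = signChar (S \ T) x * signChar (T \ S) x := by
    unfold signChar
    rw [← Finset.prod_union disjoint_sdiff_sdiff]
    rfl
  rw [hS, hT, hD]
  linear_combination signChar (S \ T) x * signChar (T \ S) x * hI

theorem flipSign_involutive (v : ι) : Function.Involutive (flipSign v) := by
  intro x
  simp [flipSign]

theorem signChar_flipSign_of_notMem {S : Finset ι} {v : ι} (hv : v ∉ S) (x : ι → ℤˣ) :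
    signChar S (flipSign v x) = signChar S x := by
  refine Finset.prod_congr rfl fun i hi => ?_
  rw [flipSign, Function.update_of_ne (ne_of_mem_of_not_mem hi hv)]

theorem signChar_flipSign_of_mem {S : Finset ι} {v : ι} (hv : v ∈ S) (x : ι → ℤˣ) :
    signChar S (flipSign v x) = -signChar S x := by
  have h := signChar_flipSign_of_notMem (Finset.notMem_erase v S) x
  unfold signChar at h ⊢
  rw [← Finset.mul_prod_erase S _ hv, ← Finset.mul_prod_erase S _ hv, h]
  simp [flipSign]

variable [Fintype ι]

theorem sum_eq_zero_of_flipSign {h : (ι → ℤˣ) → ℝ} (v : ι)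
    (hh : ∀ x, h (flipSign v x) = -h x) : ∑ x, h x = 0 := by
  have h1 : ∑ x, h (flipSign v x) = ∑ x, h x :=
    Equiv.sum_comp (flipSign_involutive v).toPerm h
  simp only [hh, Finset.sum_neg_distrib] at h1
  linarith

/-- Fourier inversion on the cube. -/
theorem two_pow_mul_eq_sum_signChar (h : (ι → ℤˣ) → ℝ) (x : ι → ℤˣ) :
    2 ^ Fintype.card ι * h x = ∑ T : Finset ι, (∑ y, h y * signChar T y) * signChar T x := by
  simp only [Finset.sum_mul]
  rw [Finset.sum_comm]
  have : ∀ y, ∑ T : Finset ι, h y * signChar T y * signChar T x =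
      h y * if y = x then 2 ^ Fintype.card ι else 0 := fun y => by
    rw [← sum_signChar_mul_signChar, Finset.mul_sum]
    exact Finset.sum_congr rfl fun T _ => mul_assoc _ _ _
  simp only [this]
  simp [mul_comm]

end Cube

/-! ### Fourier coefficients of pairwise independent distributions -/

/-- The Fourier coefficient `𝔼_μ[∏_{j ∈ T} y_j]`. -/
noncomputable def charCoeff {k : ℕ} (μ : PMF (Fin k → ℤˣ)) (T : Finset (Fin k)) : ℝ :=
  ∑ y, (μ y).toReal * signChar T y

theorem pmf_sum_toReal {α : Type*} [Fintype α] (p : PMF α) : ∑ a, (p a).toReal = 1 := by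
  rw [← ENNReal.toReal_sum fun a _ => p.apply_ne_top a, ← tsum_fintype (L := .unconditional _),
    p.tsum_coe, ENNReal.toReal_one]

theorem pmf_sum_map {α β : Type*} [Fintype α] [Fintype β] (p : PMF α)
    (f : α → β) (g : β → ℝ) :
    ∑ b, (p.map f b).toReal * g b = ∑ a, (p a).toReal * g (f a) := by
  classical
  have h : ∀ b, (p.map f b).toReal = ∑ a, if b = f a then (p a).toReal else 0 := fun b => by
    rw [PMF.map_apply, tsum_fintype, ENNReal.toReal_sum]
    · exact Finset.sum_congr rfl fun a _ => by split_ifs <;> simp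
    · intro a _
      split_ifs
      · exact p.apply_ne_top a
      · simp
  simp only [h, Finset.sum_mul]
  rw [Finset.sum_comm]
  exact Finset.sum_congr rfl fun a _ => by simp

theorem charCoeff_empty {k : ℕ} (μ : PMF (Fin k → ℤˣ)) : charCoeff μ ∅ = 1 := by
  simp [charCoeff, signChar, pmf_sum_toReal]

theorem PairwiseIndependent.sum_pair {k : ℕ} {μ : PMF (Fin k → ℤˣ)} (hμ : PairwiseIndependent μ)
    {i j : Fin k} (hij : i ≠ j) (g : ℤˣ × ℤˣ → ℝ) :
    ∑ y, (μ y).toReal * g (y i, y j) = 4⁻¹ * ∑ b, g b := by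
  rw [← pmf_sum_map μ (fun y => (y i, y j)) g, hμ i j hij, Finset.mul_sum]
  refine Finset.sum_congr rfl fun b _ => ?_
  rw [PMF.uniformOfFintype_apply]
  norm_num

/-- A single coordinate is uniform because it is half of a uniform pair; this needs a second
coordinate, hence `2 ≤ k`. -/
theorem PairwiseIndependent.charCoeff_eq_zero {k : ℕ} (hk : 2 ≤ k) {μ : PMF (Fin k → ℤˣ)}
    (hμ : PairwiseIndependent μ) {T : Finset (Fin k)} (hT : T.Nonempty) (hT2 : T.card ≤ 2) :
    charCoeff μ T = 0 := by
  have hu : (Finset.univ : Finset ℤˣ) = {1, -1} := by decide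
  rcases (by have := hT.card_pos; omega : T.card = 1 ∨ T.card = 2) with h | h
  · obtain ⟨i, rfl⟩ := Finset.card_eq_one.mp h
    have : Nontrivial (Fin k) := Fin.nontrivial_iff_two_le.mpr hk
    obtain ⟨j, hj⟩ := exists_ne i
    have := hμ.sum_pair hj.symm fun b => ((b.1 : ℤ) : ℝ)
    simp only [charCoeff, signChar, Finset.prod_singleton]
    rw [this, Fintype.sum_prod_type, hu]
    simp
  · obtain ⟨i, j, hij, rfl⟩ := Finset.card_eq_two.mp h
    have := hμ.sum_pair hij fun b => ((b.1 : ℤ) : ℝ) * ((b.2 : ℤ) : ℝ)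
    simp only [charCoeff, signChar, Finset.prod_pair hij]
    rw [this, Fintype.sum_prod_type, hu]
    simp

/-! ### Clause densities and cores -/

namespace CSPInstance

variable {k n : ℕ} (I : CSPInstance k n)

theorem var_mem_verts (c : Fin I.m) (j : Fin k) : I.var c j ∈ I.verts c :=
  Finset.mem_map_of_mem _ (Finset.mem_univ j)

theorem card_verts (c : Fin I.m) : (I.verts c).card = k := by
  simp [verts]

/-- The density `2^k μ_C(x_C)` of a clause with respect to the uniform distribution. -/
noncomputable def clauseDensity (μ : PMF (Fin k → ℤˣ)) (c : Fin I.m) (x : Fin n → ℤˣ) : ℝ :=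
  2 ^ k * (μ fun j => I.sgn c j * x (I.var c j)).toReal

/-- The density `∏_{C ∈ D} 2^k μ_C(x_C)` of a set of clauses. -/
noncomputable def density (μ : PMF (Fin k → ℤˣ)) (D : Finset (Fin I.m)) (x : Fin n → ℤˣ) : ℝ :=
  ∏ c ∈ D, I.clauseDensity μ c x

/-- The expectation of `f` with density `∏_{C ∈ D} 2^k μ_C(x_C)` relative to the uniform
distribution on the cube. -/
noncomputable def expect (μ : PMF (Fin k → ℤˣ)) (D : Finset (Fin I.m))
    (f : (Fin n → ℤˣ) → ℝ) : ℝ :=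
  (2 ^ n)⁻¹ * ∑ x, I.density μ D x * f x

theorem density_nonneg (μ : PMF (Fin k → ℤˣ)) (D : Finset (Fin I.m)) (x : Fin n → ℤˣ) :
    0 ≤ I.density μ D x :=
  Finset.prod_nonneg fun _ _ => mul_nonneg (by positivity) ENNReal.toReal_nonneg

theorem clauseDensity_flipSign (μ : PMF (Fin k → ℤˣ)) {c : Fin I.m} {v : Fin n}
    (hv : v ∉ I.verts c) (x : Fin n → ℤˣ) :
    I.clauseDensity μ c (flipSign v x) = I.clauseDensity μ c x := by
  have : ∀ j, flipSign v x (I.var c j) = x (I.var c j) := fun j =>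
    Function.update_of_ne (ne_of_mem_of_not_mem (I.var_mem_verts c j) hv) _ _
  simp only [clauseDensity, this]

theorem density_flipSign (μ : PMF (Fin k → ℤˣ)) {D : Finset (Fin I.m)} {v : Fin n}
    (hv : v ∉ D.biUnion I.verts) (x : Fin n → ℤˣ) :
    I.density μ D (flipSign v x) = I.density μ D x :=
  Finset.prod_congr rfl fun _ hc => I.clauseDensity_flipSign μ
    (fun h => hv (Finset.mem_biUnion.mpr ⟨_, hc, h⟩)) x

theorem clauseDensity_eq_sum (μ : PMF (Fin k → ℤˣ)) (c : Fin I.m) (x : Fin n → ℤˣ) :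
    I.clauseDensity μ c x = ∑ T : Finset (Fin k),
      charCoeff μ T * signChar T (I.sgn c) * signChar (T.map (I.var c)) x := by
  have h := two_pow_mul_eq_sum_signChar (fun y => (μ y).toReal)
    (fun j => I.sgn c j * x (I.var c j))
  rw [Fintype.card_fin] at h
  rw [clauseDensity, h]
  refine Finset.sum_congr rfl fun T _ => ?_
  rw [mul_assoc]
  congr 1
  simp [signChar, Finset.prod_mul_distrib]

/-- A clause can be dropped if every character in the Fourier expansion of its density
involves a variable which the rest of the integrand does not depend on. -/
theorem sum_mul_clauseDensity (μ : PMF (Fin k → ℤˣ)) (c : Fin I.m) (h : (Fin n → ℤˣ) → ℝ)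
    (hh : ∀ T : Finset (Fin k), T.Nonempty → charCoeff μ T = 0 ∨
      ∃ j ∈ T, ∀ x, h (flipSign (I.var c j) x) = h x) :
    ∑ x, I.clauseDensity μ c x * h x = ∑ x, h x := by
  simp only [clauseDensity_eq_sum, Finset.sum_mul]
  rw [Finset.sum_comm, Finset.sum_eq_single ∅]
  · simp [charCoeff_empty, signChar]
  · intro T _ hT
    rcases hh T (Finset.nonempty_iff_ne_empty.mpr hT) with h0 | ⟨j, hj, hjx⟩
    · simp [h0]
    · refine sum_eq_zero_of_flipSign (I.var c j) fun x => ?_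
      rw [hjx, signChar_flipSign_of_mem (Finset.mem_map_of_mem _ hj)]
      ring
  · simp

theorem expect_insert (μ : PMF (Fin k → ℤˣ)) {c : Fin I.m} {D : Finset (Fin I.m)} (hc : c ∉ D)
    (S : Finset (Fin n))
    (h : ∀ T : Finset (Fin k), T.Nonempty → charCoeff μ T = 0 ∨
      ∃ j ∈ T, I.var c j ∉ S ∪ D.biUnion I.verts) :
    I.expect μ (insert c D) (signChar S) = I.expect μ D (signChar S) := by
  unfold expect
  congr 1
  rw [← I.sum_mul_clauseDensity μ c fun x => I.density μ D x * signChar S x]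
  · exact Finset.sum_congr rfl fun x _ => by rw [density, Finset.prod_insert hc, mul_assoc]; rfl
  · intro T hT
    refine (h T hT).imp_right fun ⟨j, hj, hjS⟩ => ⟨j, hj, fun x => ?_⟩
    rw [Finset.notMem_union] at hjS
    rw [I.density_flipSign μ hjS.2, signChar_flipSign_of_notMem hjS.1]

/-- A nonempty character of the clause either contains a variable on which nothing else depends, or
lives on the at most two shared vertices, where pairwise independence kills its coefficient. -/
theorem expect_insert_of_card_le_two (hk : 2 ≤ k) {μ : PMF (Fin k → ℤˣ)}
    (hμ : PairwiseIndependent μ) {c : Fin I.m} {D : Finset (Fin I.m)} (hc : c ∉ D)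
    (S : Finset (Fin n)) (h : (I.verts c ∩ (S ∪ D.biUnion I.verts)).card ≤ 2) :
    I.expect μ (insert c D) (signChar S) = I.expect μ D (signChar S) := by
  refine I.expect_insert μ hc S fun T hT => ?_
  by_contra! hcon
  refine hcon.1 (hμ.charCoeff_eq_zero hk hT (le_trans ?_ h))
  rw [← Finset.card_map (I.var c)]
  refine Finset.card_le_card fun v hv => ?_
  obtain ⟨j, hj, rfl⟩ := Finset.mem_map.mp hv
  exact Finset.mem_inter.mpr ⟨I.var_mem_verts c j, hcon.2 j hj⟩

theorem expect_eq_zero_of_mem (μ : PMF (Fin k → ℤˣ)) {D : Finset (Fin I.m)} {S : Finset (Fin n)}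
    {v : Fin n} (hv : v ∈ S) (hD : v ∉ D.biUnion I.verts) :
    I.expect μ D (signChar S) = 0 := by
  rw [expect, sum_eq_zero_of_flipSign v, mul_zero]
  intro x
  rw [I.density_flipSign μ hD, signChar_flipSign_of_mem hv]
  ring

/-- Clauses outside `D₀` with at most two vertices in the boundary `S` and the other clauses
can be removed, until every remaining clause has three such vertices. -/
theorem exists_core (hk : 2 ≤ k) {μ : PMF (Fin k → ℤˣ)} (hμ : PairwiseIndependent μ)
    {D₀ D : Finset (Fin I.m)} (hD : D₀ ⊆ D) (S : Finset (Fin n)) :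
    ∃ F ⊆ D \ D₀, I.expect μ (D₀ ∪ F) (signChar S) = I.expect μ D (signChar S) ∧
      ∀ c ∈ F, 3 ≤ (I.verts c ∩ (S ∪ ((D₀ ∪ F).erase c).biUnion I.verts)).card := by
  classical
  -- Take a smallest `F` that preserves the expectation; a clause with at most two boundary vertices
  -- could still be dropped.
  obtain ⟨F, hF, hmin⟩ := Finset.exists_min_image
    ((D \ D₀).powerset.filter fun F =>
      I.expect μ (D₀ ∪ F) (signChar S) = I.expect μ D (signChar S)) Finset.card
    ⟨D \ D₀, by simp [Finset.union_sdiff_of_subset hD]⟩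
  simp only [Finset.mem_filter, Finset.mem_powerset] at hF hmin
  refine ⟨F, hF.1, hF.2, fun c hc => ?_⟩
  by_contra! hlt
  have hc0 : c ∉ D₀ := (Finset.mem_sdiff.mp (hF.1 hc)).2
  have he : (D₀ ∪ F).erase c = D₀ ∪ F.erase c := by
    rw [Finset.erase_union_distrib, Finset.erase_eq_of_notMem hc0]
  have h1 := I.expect_insert_of_card_le_two hk hμ (Finset.notMem_erase c (D₀ ∪ F)) S (by omega)
  rw [Finset.insert_erase (Finset.mem_union_right _ hc), he, hF.2] at h1
  have h2 := hmin (F.erase c) ⟨(Finset.erase_subset _ _).trans hF.1, h1.symm⟩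
  have h3 := Finset.card_erase_lt_of_mem hc
  omega

/-- Double counting in a set of clauses each of which has at least three vertices in the
boundary `S` or in another clause. -/
theorem core_card_le {F : Finset (Fin I.m)} {S : Finset (Fin n)}
    (hF : ∀ c ∈ F, 3 ≤ (I.verts c ∩ (S ∪ (F.erase c).biUnion I.verts)).card) :
    2 * (F.biUnion I.verts).card + 3 * F.card ≤
      2 * k * F.card + (S ∩ F.biUnion I.verts).card := by
  classical
  set U := F.biUnion I.verts with hU
  have hsub : ∀ c ∈ F, I.verts c ⊆ U := fun c hc => Finset.subset_biUnion_of_mem _ hc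
  have hdeg : ∑ v ∈ U, (F.filter fun c => v ∈ I.verts c).card = k * F.card := by
    have := Finset.sum_card_bipartiteAbove_eq_sum_card_bipartiteBelow (s := U) (t := F)
      (fun v c => v ∈ I.verts c)
    simp only [Finset.bipartiteAbove, Finset.bipartiteBelow] at this
    rw [this, mul_comm, ← smul_eq_mul, ← Finset.sum_const]
    refine Finset.sum_congr rfl fun c hc => ?_
    rw [Finset.filter_mem_eq_inter, Finset.inter_eq_right.mpr (hsub c hc), card_verts]
  -- Three of the `k` vertices of each clause are boundary vertices, so at most `k - 3` are private
  -- to it.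
  have hpriv : ∑ v ∈ U, (F.filter fun c =>
      v ∈ I.verts c ∧ v ∉ S ∪ (F.erase c).biUnion I.verts).card + 3 * F.card ≤ k * F.card := by
    have := Finset.sum_card_bipartiteAbove_eq_sum_card_bipartiteBelow (s := U) (t := F)
      (fun v c => v ∈ I.verts c ∧ v ∉ S ∪ (F.erase c).biUnion I.verts)
    simp only [Finset.bipartiteAbove, Finset.bipartiteBelow] at this
    rw [this, mul_comm 3, mul_comm k, ← smul_eq_mul, ← smul_eq_mul, ← Finset.sum_const,
      ← Finset.sum_const, ← Finset.sum_add_distrib]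
    refine Finset.sum_le_sum fun c hc => ?_
    have h1 : (U.filter fun v => v ∈ I.verts c ∧ v ∉ S ∪ (F.erase c).biUnion I.verts) ⊆
        I.verts c \ (S ∪ (F.erase c).biUnion I.verts) := fun v hv =>
      Finset.mem_sdiff.mpr (Finset.mem_filter.mp hv).2
    have h2 := Finset.card_le_card h1
    have h3 := Finset.card_sdiff_add_card_inter (I.verts c) (S ∪ (F.erase c).biUnion I.verts)
    have h4 := hF c hc
    rw [card_verts] at h3
    omega
  -- Each covered vertex lies in two clauses, or is private to one, or lies in `S`.
  have hpt : ∀ v ∈ U, 2 ≤ (F.filter fun c => v ∈ I.verts c).card +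
      (F.filter fun c => v ∈ I.verts c ∧ v ∉ S ∪ (F.erase c).biUnion I.verts).card +
      (if v ∈ S then 1 else 0) := by
    intro v hv
    obtain ⟨c, hc, hvc⟩ := Finset.mem_biUnion.mp hv
    have h1 : 1 ≤ (F.filter fun c => v ∈ I.verts c).card :=
      Finset.card_pos.mpr ⟨c, Finset.mem_filter.mpr ⟨hc, hvc⟩⟩
    split_ifs with hS
    · omega
    · by_cases hp : v ∈ (F.erase c).biUnion I.verts
      · obtain ⟨c', hc', hvc'⟩ := Finset.mem_biUnion.mp hp
        have : 1 < (F.filter fun c => v ∈ I.verts c).card :=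
          Finset.one_lt_card.mpr ⟨c, Finset.mem_filter.mpr ⟨hc, hvc⟩, c',
            Finset.mem_filter.mpr ⟨Finset.mem_of_mem_erase hc', hvc'⟩,
            (Finset.ne_of_mem_erase hc').symm⟩
        omega
      · have : 1 ≤ (F.filter fun c =>
            v ∈ I.verts c ∧ v ∉ S ∪ (F.erase c).biUnion I.verts).card :=
          Finset.card_pos.mpr ⟨c, Finset.mem_filter.mpr ⟨hc, hvc, by simp [hS, hp]⟩⟩
        omega
  have hsum := Finset.sum_le_sum hpt
  rw [Finset.sum_add_distrib, Finset.sum_add_distrib, hdeg, Finset.sum_const, smul_eq_mul,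
    ← Finset.card_filter, Finset.filter_mem_eq_inter, Finset.inter_comm U S] at hsum
  nlinarith

variable {I} in
/-- In an expanding instance a core has at most `|S|/(1-2δ)` clauses. -/
theorem Expanding.core_card_le {r : ℝ} (hI : I.Expanding r expansionDelta)
    {F : Finset (Fin I.m)} {S : Finset (Fin n)} (hr : (F.card : ℝ) ≤ r)
    (hF : ∀ c ∈ F, 3 ≤ (I.verts c ∩ (S ∪ (F.erase c).biUnion I.verts)).card) :
    99 * F.card ≤ 100 * (S ∩ F.biUnion I.verts).card := by
  have h1 := hI F hr
  have h2 := I.core_card_le hF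
  rw [expansionDelta] at h1
  have h3 : (2 : ℝ) * (F.biUnion I.verts).card + 3 * F.card ≤
      2 * k * F.card + (S ∩ F.biUnion I.verts).card := by exact_mod_cast h2
  -- With `|V(F)| ≥ (k - 1 - 1/200)|F|`, the coefficient of `|F|` left over is `2(k - 1 - 1/200) + 3
  -- - 2k = 99/100`.
  have h4 : (99 : ℝ) * F.card ≤ 100 * (S ∩ F.biUnion I.verts).card := by nlinarith
  exact_mod_cast h4

end CSPInstance

/-! ### Walks outside closed sets and short cycles -/

namespace CSPInstance

variable {k n : ℕ} (I : CSPInstance k n)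

/-- A walk of `m + 1` clauses from `v` to the clause `c`, none of them inside `V`. -/
def Reach (V : Finset (Fin n)) (v : Fin n) (m : ℕ) (c : Fin I.m) : Prop :=
  ∃ p : ℕ → Fin I.m, v ∈ I.verts (p 0) ∧ p m = c ∧ (∀ i ≤ m, ¬ I.verts (p i) ⊆ V) ∧
    ∀ i < m, (I.verts (p i) ∩ I.verts (p (i + 1))).Nonempty

variable {I}

theorem Reach.start {V : Finset (Fin n)} {v : Fin n} {c : Fin I.m} (hv : v ∈ I.verts c)
    (hc : ¬ I.verts c ⊆ V) : I.Reach V v 0 c :=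
  ⟨fun _ => c, hv, rfl, fun _ _ => hc, fun _ h => absurd h (Nat.not_lt_zero _)⟩

theorem Reach.step {V : Finset (Fin n)} {v u : Fin n} {m : ℕ} {c c' : Fin I.m}
    (h : I.Reach V v m c) (hu : u ∈ I.verts c) (hu' : u ∈ I.verts c') (hc' : ¬ I.verts c' ⊆ V) :
    I.Reach V v (m + 1) c' := by
  obtain ⟨p, h0, hm, hV, hi⟩ := h
  refine ⟨fun i => if i ≤ m then p i else c', by simpa using h0, by simp, fun i _ => ?_,
    fun i hi' => ?_⟩
  · dsimp only
    split_ifs with h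
    · exact hV i h
    · exact hc'
  · rcases Nat.lt_or_ge i m with h | h
    · simpa [h.le, Nat.succ_le_of_lt h] using hi i h
    · obtain rfl : i = m := by omega
      simpa [hm] using ⟨u, Finset.mem_inter.mpr ⟨hu, hu'⟩⟩

theorem Reach.not_subset {V : Finset (Fin n)} {v : Fin n} {m : ℕ} {c : Fin I.m}
    (h : I.Reach V v m c) : ¬ I.verts c ⊆ V := by
  obtain ⟨p, -, rfl, hV, -⟩ := h
  exact hV m le_rfl

/-- Walks may repeat a clause, so their length acts as an upper bound. The clause is nonempty
because it is not inside `V`. -/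
theorem Reach.succ {V : Finset (Fin n)} {v : Fin n} {m : ℕ} {c : Fin I.m}
    (h : I.Reach V v m c) : I.Reach V v (m + 1) c := by
  have hne : (I.verts c).Nonempty := by
    rw [Finset.nonempty_iff_ne_empty]
    intro h0
    exact h.not_subset (by simp [h0])
  obtain ⟨u, hu⟩ := hne
  exact h.step hu hu h.not_subset

theorem Reach.mono {V : Finset (Fin n)} {v : Fin n} {m m' : ℕ} {c : Fin I.m}
    (h : I.Reach V v m c) (hm : m ≤ m') : I.Reach V v m' c := by
  induction m', hm using Nat.le_induction with
  | base => exact h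
  | succ j _ ih => exact ih.succ

/-- A walk of at most `R` clauses between vertices of an `R`-closed set `V`, none of them
inside `V`, is trivial: a shortest such walk would be a path. -/
theorem IsRClosed.walk_eq {R : ℕ} {V : Finset (Fin n)} (hV : I.IsRClosed R V) (m : ℕ) :
    ∀ (p : ℕ → Fin I.m) (v v' : Fin n), m + 1 ≤ R → v ∈ V → v' ∈ V →
      v ∈ I.verts (p 0) → v' ∈ I.verts (p m) → (∀ i ≤ m, ¬ I.verts (p i) ⊆ V) →
      (∀ i < m, (I.verts (p i) ∩ I.verts (p (i + 1))).Nonempty) → v = v' := by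
  induction m using Nat.strong_induction_on with
  | _ m ih =>
  intro p v v' hR hv hv' h0 hm hp hstep
  by_contra hne
  -- In a walk with no shorter counterexample, `v` does not recur, since the tail from a recurrence
  -- would be a shorter walk.
  have hstart : ∀ i, 0 < i → i ≤ m → v ∉ I.verts (p i) := fun i hi him hvi =>
    hne (ih (m - i) (by omega) (fun j => p (j + i)) v v' (by omega) hv hv' (by simpa using hvi)
      (by simpa [Nat.sub_add_cancel him] using hm) (fun j hj => hp _ (by omega))
      (fun j hj => by
        have := hstep (j + i) (by omega)
        rwa [show j + i + 1 = j + 1 + i by omega] at this))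
  have hend : ∀ i < m, v' ∉ I.verts (p i) := fun i him hvi =>
    hne (ih i him p v v' (by omega) hv hv' h0 hvi (fun j hj => hp _ (by omega))
      (fun j hj => hstep j (by omega)))
  have hdisj : ∀ i j, i + 1 < j → j ≤ m → Disjoint (I.verts (p i)) (I.verts (p j)) := by
    intro i j hij hj
    rw [Finset.disjoint_iff_inter_eq_empty, ← Finset.not_nonempty_iff_eq_empty]
    intro hint
    -- Jump from clause `i` directly to clause `j`, skipping the `j - i - 1` clauses in between.
    refine hne (ih (m - (j - i - 1)) (by omega)
      (fun l => if l ≤ i then p l else p (l + (j - i - 1))) v v' (by omega) hv hv'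
      (by simpa using h0) ?_ (fun l hl => ?_) (fun l hl => ?_))
    · rw [if_neg (by omega), Nat.sub_add_cancel (by omega)]
      exact hm
    · split_ifs
      · exact hp _ (by omega)
      · exact hp _ (by omega)
    · rcases lt_trichotomy l i with h | h | h
      · rw [if_pos h.le, if_pos (by omega)]
        exact hstep _ (by omega)
      · rw [if_pos h.le, if_neg (by omega), h, show i + 1 + (j - i - 1) = j by omega]
        exact hint
      · rw [if_neg (by omega), if_neg (by omega),
          show l + 1 + (j - i - 1) = l + (j - i - 1) + 1 by omega]
        exact hstep _ (by omega)
  have hnonempty : ∀ i ≤ m, (I.verts (p i)).Nonempty := fun i hi => by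
    rw [Finset.nonempty_iff_ne_empty]
    intro h
    exact hp i hi (by simp [h])
  have hinj : ∀ i j, i < j → j ≤ m → p i ≠ p j := by
    intro i j hij hj he
    rcases Nat.lt_or_ge (i + 1) j with h | h
    · have := hdisj i j h hj
      rw [he, disjoint_self] at this
      exact (hnonempty j hj).ne_empty this
    -- Equal neighbours: at the end of the walk, `v'` would occur too early; otherwise clause `i`
    -- would meet clause `i + 2`.
    · obtain rfl : j = i + 1 := by omega
      rcases hj.eq_or_lt with h' | h'
      · exact hend i (by omega) (by rwa [he, h'])
      · have h1 := hdisj i (i + 2) (by omega) h'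
        rw [he, Finset.disjoint_iff_inter_eq_empty] at h1
        exact (hstep (i + 1) h').ne_empty h1
  refine hp 0 (Nat.zero_le _) (hV v hv v' hv' (m + 1) hR (fun i => p i)
    ⟨m.succ_pos, hne, ⟨?_, ?_, ?_⟩, ?_, ?_⟩ 0)
  · intro i j he
    rcases lt_trichotomy i j with h | h | h
    · exact absurd he (hinj _ _ h (by omega))
    · exact h
    · exact absurd he.symm (hinj _ _ h (by omega))
  · intro i j hij
    dsimp only
    rw [← hij]
    exact hstep _ (by omega)
  · intro i j hij
    exact hdisj _ _ hij (by omega)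
  · intro i
    constructor
    · intro h
      by_contra h0
      exact hstart i (by omega) (by omega) h
    · intro h
      dsimp only
      rwa [h]
  · intro i
    constructor
    · intro h
      by_contra h0
      exact hend i (by omega) h
    · intro h
      dsimp only
      rwa [show (i : ℕ) = m by omega]

theorem Reach.eq_of_mem {R : ℕ} {V : Finset (Fin n)} (hV : I.IsRClosed R V) {v v' : Fin n}
    (hv : v ∈ V) (hv' : v' ∈ V) {m : ℕ} {c : Fin I.m} (h : I.Reach V v m c) (hm : m + 1 ≤ R)
    (hc : v' ∈ I.verts c) : v = v' := by
  obtain ⟨p, h0, rfl, hp, hs⟩ := h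
  exact hV.walk_eq m p v v' hm hv hv' h0 hc hp hs

/-- The two walks glue at their common clause to a walk of `m + m' + 1` clauses; the induction moves
clauses from the second walk to the first. Hence balls around distinct vertices of `V` are disjoint.
-/
theorem Reach.eq_of_reach {R : ℕ} {V : Finset (Fin n)} (hV : I.IsRClosed R V) {v v' : Fin n}
    (hv : v ∈ V) (hv' : v' ∈ V) {m' : ℕ} : ∀ {m : ℕ} {c : Fin I.m}, I.Reach V v m c →
      I.Reach V v' m' c → m + m' + 1 ≤ R → v = v' := by
  induction m' with
  | zero =>
    rintro m c h ⟨q, h0, rfl, -, -⟩ hm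
    exact h.eq_of_mem hV hv hv' (by omega) h0
  | succ j ih =>
    rintro m c h ⟨q, h0, rfl, hq, hs⟩ hm
    obtain ⟨u, hu⟩ := hs j (by omega)
    rw [Finset.mem_inter] at hu
    exact ih (h.step hu.2 hu.1 (hq j (by omega)))
      ⟨q, h0, rfl, fun i hi => hq i (by omega), fun i hi => hs i (by omega)⟩ (by omega)

/-- Two clauses with two common vertices form a cycle of length 2. -/
theorem GirthAtLeast.eq_of_mem {g : ℝ} (hI : I.GirthAtLeast g) (hg : 3 < g) {c c' : Fin I.m}
    (hc : c ≠ c') {u u' : Fin n} (h1 : u ∈ I.verts c) (h2 : u ∈ I.verts c')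
    (h3 : u' ∈ I.verts c) (h4 : u' ∈ I.verts c') : u = u' := by
  by_contra hu
  have := hI 2 ![c, c'] ⟨le_rfl, by
    intro i j hij
    fin_cases i <;> fin_cases j <;> simp_all, ![u, u'], by
    intro i j hij
    fin_cases i <;> fin_cases j <;> simp_all, by
    intro i
    fin_cases i
    · exact ⟨h1, h2⟩
    · exact ⟨h4, h3⟩⟩
  norm_num at this
  linarith

theorem GirthAtLeast.no_triangle {g : ℝ} (hI : I.GirthAtLeast g) (hg : 3 < g)
    {c₁ c₂ c₃ : Fin I.m} (h12 : c₁ ≠ c₂) (h23 : c₂ ≠ c₃) (h13 : c₁ ≠ c₃) {u v w : Fin n}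
    (huv : u ≠ v) (hvw : v ≠ w) (huw : u ≠ w) (hu1 : u ∈ I.verts c₁) (hu2 : u ∈ I.verts c₂)
    (hv2 : v ∈ I.verts c₂) (hv3 : v ∈ I.verts c₃) (hw3 : w ∈ I.verts c₃)
    (hw1 : w ∈ I.verts c₁) : False := by
  have := hI 3 ![c₁, c₂, c₃] ⟨by norm_num, by
    intro i j hij
    fin_cases i <;> fin_cases j <;> simp_all, ![u, v, w], by
    intro i j hij
    fin_cases i <;> fin_cases j <;> simp_all, by
    intro i
    fin_cases i
    · exact ⟨hu1, hu2⟩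
    · exact ⟨hv2, hv3⟩
    · exact ⟨hw3, hw1⟩⟩
  norm_num at this
  linarith

/-! ### Closures and their size -/

variable (I)

theorem subset_rClosure (R : ℕ) (A : Finset (Fin n)) : A ⊆ I.rClosure R A := by
  intro v hv
  simp only [rClosure, Finset.mem_filter, Finset.mem_univ, true_and]
  exact fun B hB _ => hB hv

variable {I}

theorem IsRClosed.rClosure_subset {R : ℕ} {A B : Finset (Fin n)} (hB : I.IsRClosed R B)
    (hAB : A ⊆ B) : I.rClosure R A ⊆ B := by
  intro v hv
  simp only [rClosure, Finset.mem_filter, Finset.mem_univ, true_and] at hv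
  exact hv B hAB hB

theorem IsRClosed.of_le {R R' : ℕ} {A : Finset (Fin n)} (hA : I.IsRClosed R A) (h : R' ≤ R) :
    I.IsRClosed R' A :=
  fun v hv v' hv' ℓ hℓ => hA v hv v' hv' ℓ (hℓ.trans h)

variable (I)

theorem isRClosed_rClosure (R : ℕ) (A : Finset (Fin n)) : I.IsRClosed R (I.rClosure R A) := by
  intro v hv v' hv' ℓ hℓ p hp i u hu
  simp only [rClosure, Finset.mem_filter, Finset.mem_univ, true_and] at hv hv' ⊢
  exact fun B hAB hB => hB v (hv B hAB hB) v' (hv' B hAB hB) ℓ hℓ p hp i hu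

theorem clausesIn_mono {A B : Finset (Fin n)} (h : A ⊆ B) : I.clausesIn A ⊆ I.clausesIn B := by
  intro c hc
  simp only [clausesIn, Finset.mem_filter, Finset.mem_univ, true_and] at hc ⊢
  exact hc.trans h

theorem mem_clausesIn {A : Finset (Fin n)} {c : Fin I.m} : c ∈ I.clausesIn A ↔ I.verts c ⊆ A := by
  simp [clausesIn]

/-- A path between two vertices of `A` with clauses outside `F` covers few vertices
outside `A`. -/
theorem card_path_sdiff_lt {A : Finset (Fin n)} {F : Finset (Fin I.m)}
    (hF : F.biUnion I.verts ⊆ A) {v v' : Fin n} (hv : v ∈ A) (hv' : v' ∈ A) {ℓ : ℕ}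
    {p : Fin ℓ → Fin I.m} (hp : I.IsPathBetween v v' p) {i₀ : Fin ℓ} (hi₀ : p i₀ ∉ F) :
    ((Finset.univ.image p \ F).biUnion I.verts \ A).card + 1 ≤
      (k - 1) * (Finset.univ.image p \ F).card := by
  classical
  obtain ⟨hℓ, hne, ⟨hinj, hcons, hdisj⟩, hpv, hpv'⟩ := hp
  have hFA : ∀ i, p i ∈ F → I.verts (p i) ⊆ A := fun i hi =>
    (Finset.subset_biUnion_of_mem _ hi).trans hF
  set N : Finset (Fin ℓ) := Finset.univ.filter fun i => p i ∉ F with hN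
  have hmemN : ∀ i, i ∈ N ↔ p i ∉ F := fun i => by simp [hN]
  have himg : Finset.univ.image p \ F = N.image p := by
    ext c
    simp only [Finset.mem_sdiff, Finset.mem_image, Finset.mem_univ, true_and, hmemN]
    constructor
    · rintro ⟨⟨i, rfl⟩, h⟩
      exact ⟨i, h, rfl⟩
    · rintro ⟨i, h, rfl⟩
      exact ⟨⟨i, rfl⟩, h⟩
  -- Each clause has an entry vertex: `v` for the first one, a vertex shared with the preceding
  -- clause for the others. It is never a new vertex first seen in that clause, so each clause
  -- contributes at most `k - 1`.
  have hentry : ∀ i : Fin ℓ, ∃ w ∈ I.verts (p i), (w = v ∧ (i : ℕ) = 0) ∨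
      ∃ j : Fin ℓ, (j : ℕ) + 1 = i ∧ w ∈ I.verts (p j) := by
    intro i
    rcases Nat.eq_zero_or_pos (i : ℕ) with h | h
    · exact ⟨v, (hpv i).mpr h, Or.inl ⟨rfl, h⟩⟩
    · obtain ⟨w, hw⟩ := hcons ⟨i - 1, by omega⟩ i (by simp; omega)
      rw [Finset.mem_inter] at hw
      exact ⟨w, hw.2, Or.inr ⟨⟨i - 1, by omega⟩, by simp; omega, hw.1⟩⟩
  choose w hw hw' using hentry
  obtain ⟨b, hb, hbmax⟩ := Finset.exists_max_image N id ⟨i₀, (hmemN _).mpr hi₀⟩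
  -- The last clause `b` outside `F` has a second old vertex, its exit towards `v'` or towards a
  -- clause of `F`; this saves the extra 1.
  have hexit : ∃ z ∈ I.verts (p b), z ∈ A ∧ z ≠ w b := by
    rcases (by omega : (b : ℕ) + 1 = ℓ ∨ (b : ℕ) + 1 < ℓ) with h | h
    · refine ⟨v', (hpv' b).mpr h, hv', fun hz => ?_⟩
      rcases hw' b with ⟨h1, -⟩ | ⟨j, hj, hwj⟩
      · exact hne (h1.symm.trans hz.symm)
      · rw [← hz, hpv'] at hwj
        omega
    · set b' : Fin ℓ := ⟨b + 1, h⟩ with hb'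
      obtain ⟨z, hz⟩ := hcons b b' rfl
      rw [Finset.mem_inter] at hz
      have hb'F : p b' ∈ F := by
        by_contra hcon
        have := hbmax b' ((hmemN _).mpr hcon)
        simp only [id, Fin.le_def, hb'] at this
        omega
      refine ⟨z, hz.1, hFA _ hb'F hz.2, fun hzw => ?_⟩
      rcases hw' b with ⟨h1, -⟩ | ⟨j, hj, hwj⟩
      · rw [hzw, h1] at hz
        simpa [hb'] using (hpv b').mp hz.2
      · exact Finset.disjoint_left.mp (hdisj j b' (by simp [hb']; omega)) hwj (hzw ▸ hz.2)
  obtain ⟨z, hzb, hzA, hzw⟩ := hexit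
  have hcover : (Finset.univ.image p \ F).biUnion I.verts \ A ⊆
      N.biUnion fun i => if i = b then ((I.verts (p i)).erase (w i)).erase z
        else (I.verts (p i)).erase (w i) := by
    intro u hu
    rw [himg, Finset.mem_sdiff, Finset.image_biUnion, Finset.mem_biUnion] at hu
    obtain ⟨⟨j, -, hj⟩, huA⟩ := hu
    -- Charge `u` to the first clause of the path containing it.
    obtain ⟨i, hi, himin⟩ := Finset.exists_min_image
      (Finset.univ.filter fun i => u ∈ I.verts (p i)) id ⟨j, by simpa using hj⟩
    simp only [Finset.mem_filter, Finset.mem_univ, true_and, id] at hi himin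
    have huw : u ≠ w i := by
      intro h
      rcases hw' i with ⟨h1, -⟩ | ⟨j, hj, hwj⟩
      · exact huA (by rwa [h, h1])
      · have := himin j (h ▸ hwj)
        rw [Fin.le_def] at this
        omega
    refine Finset.mem_biUnion.mpr ⟨i, (hmemN _).mpr fun h => huA (hFA _ h hi), ?_⟩
    split_ifs with hib
    · exact Finset.mem_erase.mpr ⟨fun h => huA (h ▸ hzA), Finset.mem_erase.mpr ⟨huw, hi⟩⟩
    · exact Finset.mem_erase.mpr ⟨huw, hi⟩
  have hk : ∀ i, ((I.verts (p i)).erase (w i)).card = k - 1 := fun i => by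
    rw [Finset.card_erase_of_mem (hw i), card_verts]
  have hkb : (((I.verts (p b)).erase (w b)).erase z).card + 1 = k - 1 := by
    rw [← hk b, Finset.card_erase_add_one (Finset.mem_erase.mpr ⟨hzw, hzb⟩)]
  calc _ ≤ (∑ i ∈ N, (if i = b then ((I.verts (p i)).erase (w i)).erase z
        else (I.verts (p i)).erase (w i)).card) + 1 :=
        Nat.add_le_add_right ((Finset.card_le_card hcover).trans Finset.card_biUnion_le) 1
    _ = (k - 1) * N.card := by
        rw [← Finset.add_sum_erase N _ hb, if_pos rfl, add_right_comm, hkb,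
          Finset.sum_congr rfl fun i hi => by rw [if_neg (Finset.ne_of_mem_erase hi), hk],
          Finset.sum_const, smul_eq_mul, ← Finset.card_erase_add_one hb]
        ring
    _ = _ := by rw [himg, Finset.card_image_of_injective _ hinj]

variable {I}

/-- In an expanding instance the `5`-closure of a small set contains few clauses. -/
theorem Expanding.card_clausesIn_rClosure (hk : 2 ≤ k) {r : ℝ}
    (hI : I.Expanding r expansionDelta) {S : Finset (Fin n)} (hS : (6 * S.card + 5 : ℝ) ≤ r) :
    ((I.clausesIn (I.rClosure 5 S)).card : ℝ) ≤ r := by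
  classical
  -- The inequality says that each clause adds, on average, at most `k - 1 - 1/5` new vertices. It
  -- survives adding at most five clauses that save one vertex in total, so a maximal `F` absorbs
  -- all short paths.
  obtain ⟨F, hF, hmax⟩ := Finset.exists_max_image
    ((Finset.univ : Finset (Finset (Fin I.m))).filter fun F => (F.card : ℝ) ≤ r ∧
      5 * (S ∪ F.biUnion I.verts).card + F.card ≤ 5 * S.card + 5 * (k - 1) * F.card)
    Finset.card ⟨∅, by simp; linarith [(Nat.cast_nonneg S.card : (0 : ℝ) ≤ S.card)]⟩
  simp only [Finset.mem_filter, Finset.mem_univ, true_and] at hF hmax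
  obtain ⟨hFr, hFS⟩ := hF
  set A := S ∪ F.biUnion I.verts with hA
  have hcard : (F.card : ℝ) + 5 ≤ r := by
    have h1 := hI F hFr
    have h2 : ((F.biUnion I.verts).card : ℝ) ≤ A.card := by
      exact_mod_cast Finset.card_le_card Finset.subset_union_right
    have h3 : (5 : ℝ) * A.card + F.card ≤ 5 * S.card + 5 * (k - 1) * F.card := by
      have : ((5 * A.card + F.card : ℕ) : ℝ) ≤ (5 * S.card + 5 * (k - 1) * F.card : ℕ) := by
        exact_mod_cast hFS
      push_cast [Nat.cast_sub (by omega : 1 ≤ k)] at this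
      exact this
    rw [expansionDelta] at h1
    -- Expansion bounds the saving by `|F|/40`, so `|F| ≤ (200/39)|S| ≤ 6|S|`; this leaves room for
    -- five more clauses.
    have h4 : (39 : ℝ) * F.card ≤ 200 * S.card := by nlinarith
    linarith
  have hext : ∀ G : Finset (Fin I.m), G.Nonempty → Disjoint F G → G.card ≤ 5 →
      ¬ ((G.biUnion I.verts \ A).card + 1 ≤ (k - 1) * G.card) := by
    intro G hG hFG hG5 hcon
    have h1 : (F ∪ G).card = F.card + G.card := Finset.card_union_of_disjoint hFG
    have h2 : (S ∪ (F ∪ G).biUnion I.verts).card ≤ A.card + (G.biUnion I.verts \ A).card := by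
      rw [Finset.union_biUnion, ← Finset.union_assoc, ← hA, ← Finset.union_sdiff_self_eq_union]
      exact Finset.card_union_le _ _
    have h3 := hmax (F ∪ G) ⟨by
      rw [h1]
      push_cast
      have : (G.card : ℝ) ≤ 5 := by exact_mod_cast hG5
      linarith, by
      rw [h1]
      nlinarith⟩
    have := hG.card_pos
    omega
  have hAF : I.clausesIn A ⊆ F := by
    intro c hc
    by_contra hcF
    refine hext {c} ⟨c, by simp⟩ (by simpa using hcF) (by simp) ?_
    rw [Finset.singleton_biUnion, Finset.sdiff_eq_empty_iff_subset.mpr (I.mem_clausesIn.mp hc)]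
    simp
    omega
  have hclosed : I.IsRClosed 5 A := by
    intro v hv v' hv' ℓ hℓ p hp i
    by_cases hi : p i ∈ F
    · exact (Finset.subset_biUnion_of_mem I.verts hi).trans Finset.subset_union_right
    · refine absurd (I.card_path_sdiff_lt Finset.subset_union_right hv hv' hp hi)
        (hext _ ⟨p i, by simp [hi]⟩ Finset.disjoint_sdiff ?_)
      calc _ ≤ (Finset.univ.image p).card := Finset.card_le_card Finset.sdiff_subset
        _ ≤ ℓ := by simpa using Finset.card_image_le (s := Finset.univ) (f := p)
        _ ≤ 5 := hℓ
  refine le_trans ?_ hFr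
  exact_mod_cast Finset.card_le_card
    ((I.clausesIn_mono (hclosed.rClosure_subset Finset.subset_union_left)).trans hAF)

end CSPInstance

/-! ### Private neighbourhoods and the decay of correlations -/

namespace CSPInstance

variable {k n : ℕ} {I : CSPInstance k n}

/-- Of three boundary vertices at least two differ from `v`, so a core entered at `v` branches at
every clause. -/
theorem exists_two_branches {F : Finset (Fin I.m)} {S : Finset (Fin n)} {c : Fin I.m}
    (hc : 3 ≤ (I.verts c ∩ (S ∪ (F.erase c).biUnion I.verts)).card) (v : Fin n) :
    ∃ u ∈ I.verts c, ∃ w ∈ I.verts c, u ≠ w ∧ u ≠ v ∧ w ≠ v ∧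
      (u ∈ S ∨ ∃ d ∈ F, d ≠ c ∧ u ∈ I.verts d) ∧ (w ∈ S ∨ ∃ d ∈ F, d ≠ c ∧ w ∈ I.verts d) := by
  have h1 := Finset.pred_card_le_card_erase
    (s := I.verts c ∩ (S ∪ (F.erase c).biUnion I.verts)) (a := v)
  obtain ⟨u, hu, w, hw, huw⟩ := Finset.one_lt_card.mp
    (show 1 < ((I.verts c ∩ (S ∪ (F.erase c).biUnion I.verts)).erase v).card by omega)
  simp only [Finset.mem_erase, Finset.mem_inter, Finset.mem_union, Finset.mem_biUnion] at hu hw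
  refine ⟨u, hu.2.1, w, hw.2.1, huw, hu.1, hw.1, hu.2.2.imp_right ?_, hw.2.2.imp_right ?_⟩
  · rintro ⟨d, hd, hud⟩
    exact ⟨d, hd.2, hd.1, hud⟩
  · rintro ⟨d, hd, hud⟩
    exact ⟨d, hd.2, hd.1, hud⟩

/-- A core clause `c` at `v` has two further boundary vertices. Closedness keeps them out of `V`, so
each leads to another clause; these differ since no two clauses share two vertices. -/
theorem exists_three_private_clauses {V : Finset (Fin n)} (hV : I.IsRClosed 3 V) {g : ℝ}
    (hgirth : I.GirthAtLeast g) (hg : 3 < g) {F : Finset (Fin I.m)}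
    (hFV : ∀ c ∈ F, ¬ I.verts c ⊆ V)
    (hF : ∀ c ∈ F, 3 ≤ (I.verts c ∩ (V ∪ (F.erase c).biUnion I.verts)).card)
    {v : Fin n} (hv : v ∈ V) (hvF : v ∈ F.biUnion I.verts) :
    ∃ N ⊆ F, 3 ≤ N.card ∧ ∀ c ∈ N, I.Reach V v 1 c := by
  obtain ⟨c, hc, hvc⟩ := Finset.mem_biUnion.mp hvF
  have hr := Reach.start hvc (hFV c hc)
  have hcV : ∀ u ∈ I.verts c, u ≠ v → u ∉ V := fun u hu huv huV =>
    huv (hr.eq_of_mem hV hv huV (by norm_num) hu).symm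
  obtain ⟨u, hu, w, hw, huw, huv, hwv, hu', hw'⟩ := exists_two_branches (hF c hc) v
  obtain ⟨d, hd, hdc, hud⟩ := hu'.resolve_left (hcV u hu huv)
  obtain ⟨e, he, hec, hwe⟩ := hw'.resolve_left (hcV w hw hwv)
  have hde : d ≠ e := by
    rintro rfl
    exact huw (hgirth.eq_of_mem hg hdc hud hu hwe hw)
  refine ⟨{c, d, e}, ?_, ?_, ?_⟩
  · simp [Finset.insert_subset_iff, hc, hd, he]
  · rw [Finset.card_eq_three.mpr ⟨c, d, e, hdc.symm, hec.symm, hde, rfl⟩]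
  · simp only [Finset.mem_insert, Finset.mem_singleton]
    rintro x (rfl | rfl | rfl)
    · exact hr.succ
    · exact hr.step hu hud (hFV _ hd)
    · exact hr.step hw hwe (hFV _ he)

/-- Marginals are consistent: adding clauses outside a `3`-closed set does not change the
expectations of characters supported on it. -/
theorem Expanding.expect_eq_of_isRClosed (hk : 2 ≤ k) {μ : PMF (Fin k → ℤˣ)}
    (hμ : PairwiseIndependent μ) {r g : ℝ} (hI : I.Expanding r expansionDelta)
    (hgirth : I.GirthAtLeast g) (hg : 3 < g) {V S : Finset (Fin n)} (hV : I.IsRClosed 3 V)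
    (hSV : S ⊆ V) {D : Finset (Fin I.m)} (hD : I.clausesIn V ⊆ D) (hr : (D.card : ℝ) ≤ r) :
    I.expect μ D (signChar S) = I.expect μ (I.clausesIn V) (signChar S) := by
  classical
  obtain ⟨F, hFD, hFe, hF⟩ := I.exists_core hk hμ hD S
  have hFV : ∀ c ∈ F, ¬ I.verts c ⊆ V := fun c hc h =>
    (Finset.mem_sdiff.mp (hFD hc)).2 (I.mem_clausesIn.mpr h)
  -- The clauses inside `V` are absorbed by enlarging the boundary from `S` to `V`, so `F` alone is
  -- a core.
  have hF' : ∀ c ∈ F, 3 ≤ (I.verts c ∩ (V ∪ (F.erase c).biUnion I.verts)).card := by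
    intro c hc
    refine (hF c hc).trans (Finset.card_le_card (Finset.inter_subset_inter_left ?_))
    refine Finset.union_subset (hSV.trans Finset.subset_union_left) ?_
    refine Finset.biUnion_subset.mpr fun d hd => ?_
    rw [Finset.mem_erase, Finset.mem_union] at hd
    rcases hd.2 with h | h
    · exact (I.mem_clausesIn.mp h).trans Finset.subset_union_left
    · exact (Finset.subset_biUnion_of_mem I.verts
        (Finset.mem_erase.mpr ⟨hd.1, h⟩)).trans Finset.subset_union_right
  have hFr : (F.card : ℝ) ≤ r := le_trans (by
    exact_mod_cast Finset.card_le_card (hFD.trans Finset.sdiff_subset)) hr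
  have hcount := hI.core_card_le hFr hF'
  have hN : ∀ v : {v // v ∈ V ∩ F.biUnion I.verts},
      ∃ N ⊆ F, 3 ≤ N.card ∧ ∀ c ∈ N, I.Reach V v 1 c := fun v =>
    exists_three_private_clauses hV hgirth hg hFV hF' (Finset.mem_inter.mp v.2).1
      (Finset.mem_inter.mp v.2).2
  choose N hNF hN3 hNr using hN
  have hsum : ∑ v, (N v).card ≤ F.card := by
    rw [← Finset.card_biUnion]
    · exact Finset.card_le_card (Finset.biUnion_subset.mpr fun v _ => hNF v)
    · intro v _ v' _ hne
      refine Finset.disjoint_left.mpr fun c hc hc' => hne (Subtype.ext ?_)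
      exact (hNr v c hc).eq_of_reach hV (Finset.mem_inter.mp v.2).1
        (Finset.mem_inter.mp v'.2).1 (hNr v' c hc') (by norm_num)
  have h3 := (Finset.card_nsmul_le_sum Finset.univ (fun v => (N v).card) 3
    fun v _ => hN3 v).trans hsum
  rw [Finset.card_univ, Fintype.card_coe, smul_eq_mul] at h3
  -- For `s = |V ∩ V(F)|`, both `3s ≤ |F|` and `99|F| ≤ 100s`, which forces `|F| = 0`.
  have : F = ∅ := Finset.card_eq_zero.mp (by omega)
  rw [← hFe, this, Finset.union_empty]

/-- Follow two branches out of a clause at `v` until each stops in `S` or enough clauses have been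
met. The pairs `(|N|, |Θ|)` that occur are `(1,2)`, `(3,1)` and `(4,0)`, all of weight at least 8.
Walks of three clauses suffice, and two of them sharing their last clause have five in total, whence
5-closedness. -/
theorem exists_private_ball {V S : Finset (Fin n)} (hV : I.IsRClosed 5 V) {g : ℝ}
    (hgirth : I.GirthAtLeast g) (hg : 3 < g) {F : Finset (Fin I.m)}
    (hFV : ∀ c ∈ F, ¬ I.verts c ⊆ V)
    (hF : ∀ c ∈ F, 3 ≤ (I.verts c ∩ (S ∪ (F.erase c).biUnion I.verts)).card)
    {v : Fin n} (hv : v ∈ V) (hvF : v ∈ F.biUnion I.verts) :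
    ∃ N ⊆ F, ∃ Θ ⊆ S \ V, 8 ≤ 2 * N.card + 3 * Θ.card ∧ (∀ c ∈ N, I.Reach V v 2 c) ∧
      ∀ u ∈ Θ, ∃ c, u ∈ I.verts c ∧ I.Reach V v 1 c := by
  obtain ⟨c, hc, hvc⟩ := Finset.mem_biUnion.mp hvF
  have hr := Reach.start hvc (hFV c hc)
  have hcV : ∀ u ∈ I.verts c, u ≠ v → u ∉ V := fun u hu huv huV =>
    huv (hr.eq_of_mem hV hv huV (by norm_num) hu).symm
  have htwo : ∀ {d e : Fin I.m}, d ≠ e → ∀ {u w : Fin n}, u ≠ w → u ∈ I.verts d →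
      u ∈ I.verts e → w ∈ I.verts d → w ∈ I.verts e → False := fun hde _ _ huw h1 h2 h3 h4 =>
    huw (hgirth.eq_of_mem hg hde h1 h2 h3 h4)
  obtain ⟨u, hu, w, hw, huw, huv, hwv, hu', hw'⟩ := exists_two_branches (hF c hc) v
  have huV := hcV u hu huv
  have hwV := hcV w hw hwv
  -- A branch through a further clause `d` yields another vertex `x` outside `V`.
  have hbranch : ∀ {w : Fin n}, w ∈ I.verts c → w ≠ v → ∀ {d : Fin I.m}, d ∈ F → d ≠ c →
      w ∈ I.verts d → ∃ x ∈ I.verts d, x ≠ w ∧ x ∉ V ∧ x ∉ I.verts c ∧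
        (x ∈ S ∨ ∃ e ∈ F, e ≠ d ∧ x ∈ I.verts e) := by
    intro w hw hwv d hd hdc hwd
    obtain ⟨x, hx, y, hy, hxy, hxw, hyw, hx', hy'⟩ := exists_two_branches (hF d hd) w
    have hrd := hr.step hw hwd (hFV d hd)
    refine ⟨x, hx, hxw, fun hxV => ?_, fun hxc => htwo hdc hxw hx hxc hwd hw, hx'⟩
    have := hrd.eq_of_mem hV hv hxV (by norm_num) hx
    exact htwo hdc hwv hwd hw (this ▸ hx) hvc
  -- One branch ends in `S`, the other one goes on through `d`.
  have hmixed : ∀ {u w : Fin n}, u ∈ I.verts c → w ∈ I.verts c → u ≠ w → u ∉ V → w ≠ v →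
      u ∈ S → ∀ {d : Fin I.m}, d ∈ F → d ≠ c → w ∈ I.verts d →
      ∃ N ⊆ F, ∃ Θ ⊆ S \ V, 8 ≤ 2 * N.card + 3 * Θ.card ∧ (∀ c ∈ N, I.Reach V v 2 c) ∧
        ∀ u ∈ Θ, ∃ c, u ∈ I.verts c ∧ I.Reach V v 1 c := by
    intro u w hu hw huw huV hwv huS d hd hdc hwd
    have hrd := hr.step hw hwd (hFV d hd)
    obtain ⟨x, hx, hxw, hxV, hxc, hxS | ⟨e, he, hed, hxe⟩⟩ := hbranch hw hwv hd hdc hwd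
    · have hux : u ≠ x := fun h => hxc (h ▸ hu)
      refine ⟨{c}, by simpa using hc, {u, x}, ?_, ?_, ?_, ?_⟩
      · simp [Finset.insert_subset_iff, huS, huV, hxS, hxV]
      · rw [Finset.card_pair hux]
        simp
      · simpa using hr.mono (by norm_num)
      · simp only [Finset.mem_insert, Finset.mem_singleton]
        rintro y (rfl | rfl)
        · exact ⟨c, hu, hr.succ⟩
        · exact ⟨d, hx, hrd⟩
    · have hec : e ≠ c := by
        rintro rfl
        exact hxc hxe
      refine ⟨{c, d, e}, ?_, {u}, ?_, ?_, ?_, ?_⟩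
      · simp [Finset.insert_subset_iff, hc, hd, he]
      · simp [huS, huV]
      · rw [Finset.card_eq_three.mpr ⟨c, d, e, hdc.symm, hec.symm, hed.symm, rfl⟩]
        simp
      · simp only [Finset.mem_insert, Finset.mem_singleton]
        rintro y (rfl | rfl | rfl)
        · exact hr.mono (by norm_num)
        · exact hrd.succ
        · exact hrd.step hx hxe (hFV _ he)
      · simpa using ⟨c, hu, hr.succ⟩
  rcases hu' with huS | ⟨d, hd, hdc, hud⟩ <;> rcases hw' with hwS | ⟨e, he, hec, hwe⟩
  · refine ⟨{c}, by simpa using hc, {u, w}, ?_, ?_, ?_, ?_⟩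
    · simp [Finset.insert_subset_iff, huS, huV, hwS, hwV]
    · rw [Finset.card_pair huw]
      simp
    · simpa using hr.mono (by norm_num)
    · simp only [Finset.mem_insert, Finset.mem_singleton]
      rintro y (rfl | rfl)
      · exact ⟨c, hu, hr.succ⟩
      · exact ⟨c, hw, hr.succ⟩
  · exact hmixed hu hw huw huV hwv huS he hec hwe
  · exact hmixed hw hu huw.symm hwV huv hwS hd hdc hud
  · have hde : d ≠ e := by
      rintro rfl
      exact htwo hdc huw hud hu hwe hw
    have hrd := hr.step hu hud (hFV d hd)
    have hre := hr.step hw hwe (hFV e he)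
    obtain ⟨x, hx, hxu, hxV, hxc, hxS | ⟨f, hf, hfd, hxf⟩⟩ := hbranch hu huv hd hdc hud
    · refine ⟨{c, d, e}, ?_, {x}, ?_, ?_, ?_, ?_⟩
      · simp [Finset.insert_subset_iff, hc, hd, he]
      · simp [hxS, hxV]
      · rw [Finset.card_eq_three.mpr ⟨c, d, e, hdc.symm, hec.symm, hde, rfl⟩]
        simp
      · simp only [Finset.mem_insert, Finset.mem_singleton]
        rintro y (rfl | rfl | rfl)
        · exact hr.mono (by norm_num)
        · exact hrd.succ
        · exact hre.succ
      · simpa using ⟨d, hx, hrd⟩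
    · have hfc : f ≠ c := by
        rintro rfl
        exact hxc hxf
      -- Otherwise `c`, `d`, `e` would form a triangle.
      have hfe : f ≠ e := by
        rintro rfl
        exact hgirth.no_triangle hg hdc.symm hfd.symm hec.symm hxu.symm
          (fun h => hxc (h ▸ hw)) huw hu hud hx hxf hwe hw
      refine ⟨{f, c, d, e}, ?_, ∅, by simp, ?_, ?_, by simp⟩
      · simp [Finset.insert_subset_iff, hc, hd, he, hf]
      · rw [Finset.card_insert_of_notMem (by simp [hfc, hfd, hfe]),
          Finset.card_eq_three.mpr ⟨c, d, e, hdc.symm, hec.symm, hde, rfl⟩]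
        simp
      · simp only [Finset.mem_insert, Finset.mem_singleton]
        rintro y (rfl | rfl | rfl | rfl)
        · exact hrd.step hx hxf (hFV _ hf)
        · exact hr.mono (by norm_num)
        · exact hrd.succ
        · exact hre.succ

/-- If clauses outside the `5`-closed set `V` correlate a character on `T ⊄ V` with a character
on `B ⊆ V`, then `B` is smaller than `T`. -/
theorem Expanding.card_lt_of_expect_ne_zero (hk : 2 ≤ k) {μ : PMF (Fin k → ℤˣ)}
    (hμ : PairwiseIndependent μ) {r g : ℝ} (hI : I.Expanding r expansionDelta)
    (hgirth : I.GirthAtLeast g) (hg : 3 < g) {V B T : Finset (Fin n)} (hV : I.IsRClosed 5 V)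
    (hBV : B ⊆ V) (hTV : ¬ T ⊆ V) {D : Finset (Fin I.m)} (hD : Disjoint D (I.clausesIn V))
    (hr : (D.card : ℝ) ≤ r) (hne : I.expect μ D (signChar (symmDiff T B)) ≠ 0) :
    B.card < T.card := by
  classical
  obtain ⟨F, hFD, hFe, hF⟩ := I.exists_core hk hμ (Finset.empty_subset D) (symmDiff T B)
  rw [Finset.sdiff_empty] at hFD
  rw [Finset.empty_union] at hFe hF
  set S := symmDiff T B with hS
  have hFV : ∀ c ∈ F, ¬ I.verts c ⊆ V := fun c hc h =>
    Finset.disjoint_left.mp hD (hFD hc) (I.mem_clausesIn.mpr h)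
  have hFr : (F.card : ℝ) ≤ r := le_trans (by exact_mod_cast Finset.card_le_card hFD) hr
  have hSF : ∀ v ∈ S, v ∈ F.biUnion I.verts := fun v hv => by
    by_contra h
    exact hne (hFe ▸ I.expect_eq_zero_of_mem μ hv h)
  have hcount := hI.core_card_le hFr hF
  have hN : ∀ v : {v // v ∈ S ∩ V}, ∃ N ⊆ F, ∃ Θ ⊆ S \ V, 8 ≤ 2 * N.card + 3 * Θ.card ∧
      (∀ c ∈ N, I.Reach V v 2 c) ∧ ∀ u ∈ Θ, ∃ c, u ∈ I.verts c ∧ I.Reach V v 1 c := fun v =>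
    exists_private_ball hV hgirth hg hFV hF (Finset.mem_inter.mp v.2).2
      (hSF v (Finset.mem_inter.mp v.2).1)
  choose N hNF Θ hΘS h8 hNr hΘr using hN
  have hsumN : ∑ v, (N v).card ≤ F.card := by
    rw [← Finset.card_biUnion]
    · exact Finset.card_le_card (Finset.biUnion_subset.mpr fun v _ => hNF v)
    · intro v _ v' _ hne
      refine Finset.disjoint_left.mpr fun c hc hc' => hne (Subtype.ext ?_)
      exact (hNr v c hc).eq_of_reach hV (Finset.mem_inter.mp v.2).2
        (Finset.mem_inter.mp v'.2).2 (hNr v' c hc') (by norm_num)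
  have hsumΘ : ∑ v, (Θ v).card ≤ (S \ V).card := by
    rw [← Finset.card_biUnion]
    · exact Finset.card_le_card (Finset.biUnion_subset.mpr fun v _ => hΘS v)
    · intro v _ v' _ hne
      refine Finset.disjoint_left.mpr fun u hu hu' => hne (Subtype.ext ?_)
      obtain ⟨c, huc, hc⟩ := hΘr v u hu
      obtain ⟨c', huc', hc'⟩ := hΘr v' u hu'
      exact (hc.step huc huc' hc'.not_subset).eq_of_reach hV (Finset.mem_inter.mp v.2).2
        (Finset.mem_inter.mp v'.2).2 hc' (by norm_num)
  have h8sum := Finset.card_nsmul_le_sum Finset.univ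
    (fun v => 2 * (N v).card + 3 * (Θ v).card) 8 fun v _ => h8 v
  rw [Finset.card_univ, Fintype.card_coe, smul_eq_mul, Finset.sum_add_distrib,
    ← Finset.mul_sum, ← Finset.mul_sum] at h8sum
  have hScard : (S ∩ F.biUnion I.verts).card ≤ S.card :=
    Finset.card_le_card Finset.inter_subset_left
  have hSsplit := Finset.card_sdiff_add_card_inter S V
  -- Since `B ⊆ V`, the character is that of `T` outside `V`.
  have hSout : S \ V = T \ V := by
    ext u
    simp only [hS, Finset.mem_sdiff, Finset.mem_symmDiff]
    have := @hBV u
    tauto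
  have hTsplit := Finset.card_sdiff_add_card_inter T V
  have hTpos : 0 < (T \ V).card := Finset.card_pos.mpr (Finset.sdiff_nonempty.mpr hTV)
  have hBle : B.card ≤ (S ∩ V).card + (T ∩ V).card := by
    refine (Finset.card_le_card fun u hu => ?_).trans (Finset.card_union_le _ _)
    simp only [Finset.mem_union, Finset.mem_inter, hS, Finset.mem_symmDiff]
    have := hBV hu
    tauto
  rw [hSout] at hsumΘ hSsplit
  -- With `s = |S ∩ V|` and `t = |T \ V|`, the bounds `8s ≤ 2|F| + 3t` and `99|F| ≤ 100(s + t)` give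
  -- `592s ≤ 497t`. As `t > 0`, `s < t`, and so `|B| ≤ s + |T ∩ V| < |T|`.
  omega

end CSPInstance

/-! ### Weighted projection and Gram–Schmidt -/

/-- Least squares: a function can be projected onto a span of functions with respect to a
nonnegative weight. -/
theorem exists_weighted_projection {X J : Type*} [Fintype X] [Fintype J] {ρ : X → ℝ}
    (hρ : ∀ x, 0 ≤ ρ x) (φ : J → X → ℝ) (ψ : X → ℝ) :
    ∃ a : J → ℝ, ∀ j, ∑ x, ρ x * ((ψ x - ∑ i, a i * φ i x) * φ j x) = 0 := by
  -- Scaling by `√ρ` turns the weighted form into the Euclidean one, even where the weight vanishes.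
  let e : (X → ℝ) → EuclideanSpace ℝ X := fun f => WithLp.toLp 2 fun x => √(ρ x) * f x
  let K := Submodule.span ℝ (Set.range fun j => e (φ j))
  obtain ⟨y, hy, z, hz, hyz⟩ := K.exists_add_mem_mem_orthogonal (e ψ)
  obtain ⟨a, rfl⟩ := (Submodule.mem_span_range_iff_exists_fun ℝ).mp hy
  refine ⟨a, fun j => ?_⟩
  have h := (Submodule.mem_orthogonal' K z).mp hz (e (φ j)) (Submodule.subset_span ⟨j, rfl⟩)
  rw [← sub_eq_iff_eq_add'] at hyz
  rw [← hyz, PiLp.inner_apply] at h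
  rw [← h]
  refine Finset.sum_congr rfl fun x _ => ?_
  have hs := Real.mul_self_sqrt (hρ x)
  have hsum : (∑ i, a i • e (φ i)) x = √(ρ x) * ∑ i, a i * φ i x := by
    simp only [WithLp.ofLp_sum, Finset.sum_apply, Finset.mul_sum, e, PiLp.smul_apply, smul_eq_mul]
    exact Finset.sum_congr rfl fun i _ => by ring
  rw [PiLp.sub_apply, hsum]
  simp only [e, RCLike.inner_apply, conj_trivial]
  linear_combination -(ψ x - ∑ i, a i * φ i x) * φ j x * hs

section GramSchmidt

variable {R : Type*} [CommRing R] [Algebra ℝ R] {ι : Type*} {L : R →ₗ[ℝ] ℝ}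

/-- A triangular change of basis `g` of `e` whose members are orthogonal to the preceding members
of `e` has the same span as `e`. -/
theorem span_range_eq_of_triangular {e g : ι → R} {r : ι → ℕ}
    (h : ∀ i, e i - g i ∈ Submodule.span ℝ (e '' {j | r j < r i})) :
    Submodule.span ℝ (Set.range g) = Submodule.span ℝ (Set.range e) := by
  apply le_antisymm
  · refine Submodule.span_le.mpr ?_
    rintro _ ⟨i, rfl⟩
    rw [← sub_sub_cancel (e i) (g i)]
    exact Submodule.sub_mem _ (Submodule.subset_span ⟨i, rfl⟩)
      (Submodule.span_mono (Set.image_subset_range _ _) (h i))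
  · refine Submodule.span_le.mpr ?_
    rintro _ ⟨i, rfl⟩
    generalize hm : r i = m
    induction m using Nat.strong_induction_on generalizing i with
    | _ m ih =>
      subst hm
      rw [← sub_add_cancel (e i) (g i)]
      refine Submodule.add_mem _ (?_ : _ ∈ _) (Submodule.subset_span ⟨i, rfl⟩)
      refine (Submodule.span_le.mpr ?_ : _ ≤ Submodule.span ℝ (Set.range g)) (h i)
      rintro _ ⟨j, hj, rfl⟩
      exact ih _ hj j rfl

/-- Each `g j` is a combination of `e j` and earlier members of `e`, all of which are orthogonal to
a later `g i`. -/
theorem orthogonal_of_triangular {e g : ι → R} {r : ι → ℕ} (hr : Function.Injective r)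
    (h : ∀ i, e i - g i ∈ Submodule.span ℝ (e '' {j | r j < r i}))
    (ho : ∀ i j, r j < r i → L (g i * e j) = 0) {i j : ι} (hij : i ≠ j) :
    L (g i * g j) = 0 := by
  have key : ∀ i j, r j < r i → L (g i * g j) = 0 := by
    intro i j hji
    have : ∀ p ∈ Submodule.span ℝ (e '' {l | r l < r j}), L (g i * p) = 0 := by
      intro p hp
      induction hp using Submodule.span_induction with
      | mem p hp =>
        obtain ⟨l, hl, rfl⟩ := hp
        exact ho i l (hl.trans hji)
      | zero => simp
      | add p q _ _ hp hq => rw [mul_add, map_add, hp, hq, add_zero]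
      | smul a p _ hp => rw [mul_smul_comm, map_smul, hp, smul_zero]
    rw [← sub_sub_cancel (e j) (g j), mul_sub, map_sub, ho i j hji, this _ (h j), sub_zero]
  rcases lt_or_gt_of_ne (hr.ne hij) with h' | h'
  · rw [mul_comm]
    exact key j i h'
  · exact key i j h'

theorem sq_nonneg_of_orthogonal [Fintype ι] {g : ι → R} (hg : ∀ i, 0 ≤ L (g i ^ 2))
    (ho : ∀ i j, i ≠ j → L (g i * g j) = 0) {f : R}
    (hf : f ∈ Submodule.span ℝ (Set.range g)) : 0 ≤ L (f ^ 2) := by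
  obtain ⟨c, rfl⟩ := (Submodule.mem_span_range_iff_exists_fun ℝ).mp hf
  have : L ((∑ i, c i • g i) ^ 2) = ∑ i, c i ^ 2 * L (g i ^ 2) := by
    rw [sq, Finset.sum_mul_sum, map_sum]
    refine Finset.sum_congr rfl fun i _ => ?_
    rw [map_sum, Finset.sum_eq_single i]
    · rw [smul_mul_smul_comm, map_smul, smul_eq_mul, sq, sq]
    · intro j _ hj
      rw [smul_mul_smul_comm, map_smul, ho i j hj.symm, smul_zero]
    · simp
  rw [this]
  exact Finset.sum_nonneg fun i _ => mul_nonneg (sq_nonneg _) (hg i)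

end GramSchmidt

/-! ### The pseudo-expectation as a local expectation -/

theorem character_eq_monomial {n : ℕ} (S : Finset (Fin n)) :
    character S = MvPolynomial.monomial (Finsupp.indicator S fun _ _ => 1) 1 := by
  classical
  rw [MvPolynomial.monomial_eq, map_one, one_mul, Finsupp.prod_of_support_subset _
    (Finsupp.support_indicator_subset S _) _ (by simp), character]
  refine Finset.prod_congr rfl fun i hi => ?_
  rw [Finsupp.indicator_of_mem hi, pow_one]

theorem eval_character {n : ℕ} (S : Finset (Fin n)) (x : Fin n → ℤˣ) :
    MvPolynomial.eval (fun i => ((x i : ℤ) : ℝ)) (character S) = signChar S x := by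
  simp [character, signChar]

namespace CSPInstance

variable {k n : ℕ} (I : CSPInstance k n)

theorem pE_character_mul (μ : PMF (Fin k → ℤˣ)) (A B : Finset (Fin n)) :
    I.pE μ (character A * character B) = I.charExpectation μ (symmDiff A B) := by
  classical
  rw [character_eq_monomial, character_eq_monomial, MvPolynomial.monomial_mul, one_mul, pE]
  have := (MvPolynomial.basisMonomials (Fin n) ℝ).constr_basis ℝ
    (fun e : Fin n →₀ ℕ => I.charExpectation μ (Finset.univ.filter fun i => Odd (e i)))
    (Finsupp.indicator A (fun _ _ => 1) + Finsupp.indicator B fun _ _ => 1)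
  rw [MvPolynomial.coe_basisMonomials] at this
  rw [this]
  congr 1
  ext i
  simp only [Finset.mem_filter, Finset.mem_univ, true_and, Finsupp.add_apply,
    Finsupp.indicator_apply, Finset.mem_symmDiff]
  by_cases hA : i ∈ A <;> by_cases hB : i ∈ B <;> simp_all

theorem sum_restrict {A : Finset (Fin n)} (G : (A → ℤˣ) → ℝ) :
    ∑ x : Fin n → ℤˣ, G (fun i => x i) = 2 ^ (n - A.card) * ∑ y, G y := by
  classical
  rw [← (Equiv.piEquivPiSubtypeProd (· ∈ A) fun _ => ℤˣ).symm.sum_comp, Fintype.sum_prod_type,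
    Finset.mul_sum]
  refine Finset.sum_congr rfl fun y _ => ?_
  have : ∀ z : {i // i ∉ A} → ℤˣ, (fun i : A =>
      (Equiv.piEquivPiSubtypeProd (· ∈ A) fun _ => ℤˣ).symm (y, z) i) = y := fun z => by
    ext i
    simp [Equiv.piEquivPiSubtypeProd]
  simp only [this]
  simp [Fintype.card_subtype_compl]

/-- This moves all local distributions to the one cube on `Fin n`: relative to the uniform measure
`ν_A` has density `∏ 2^k μ_C`, and the coordinates outside `A` integrate out. -/
theorem charExpectation_eq_expect (μ : PMF (Fin k → ℤˣ)) (S : Finset (Fin n)) :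
    I.charExpectation μ S = I.expect μ (I.clausesIn (I.cl S)) (signChar S) := by
  classical
  set A := I.cl S with hA
  set G : (A → ℤˣ) → ℝ := fun x => I.nuClosed μ A x *
    ∏ i : S, (((x ⟨i.1, I.subset_cl S i.2⟩ : ℤˣ) : ℤ) : ℝ) with hG
  have h1 : I.charExpectation μ S = ∑ x, G x := by
    rw [charExpectation, ← Finset.sum_fiberwise Finset.univ
      fun (x : A → ℤˣ) (i : S) => x ⟨i.1, I.subset_cl S i.2⟩]
    refine Finset.sum_congr rfl fun y _ => ?_
    rw [nuMarginal, Finset.sum_mul]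
    refine Finset.sum_congr (by ext; simp) fun x hx => ?_
    simp only [Finset.mem_filter, Finset.mem_univ, true_and] at hx
    rw [hG, ← hx]
  have h2 : ∀ x : Fin n → ℤˣ, I.density μ (I.clausesIn A) x * signChar S x =
      2 ^ A.card * G fun i => x i := by
    intro x
    have hprod : ∏ c ∈ (I.clausesIn A).attach, (μ fun j => I.sgn c.1 j * x (I.var c.1 j)).toReal
        = ∏ c ∈ I.clausesIn A, (μ fun j => I.sgn c j * x (I.var c j)).toReal :=
      Finset.prod_attach _ fun c => (μ fun j => I.sgn c j * x (I.var c j)).toReal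
    have hchar : ∏ i : S, (((x i : ℤˣ) : ℤ) : ℝ) = signChar S x :=
      Finset.prod_coe_sort S fun i => (((x i : ℤˣ) : ℤ) : ℝ)
    simp only [hG, nuClosed]
    rw [hprod, hchar, density]
    simp only [clauseDensity]
    rw [Finset.prod_mul_distrib, Finset.prod_const, ← pow_mul, zpow_sub₀ two_ne_zero,
      ← Nat.cast_mul, zpow_natCast, zpow_natCast]
    field_simp
  have hcard : A.card ≤ n := by simpa using Finset.card_le_univ A
  rw [h1, expect]
  simp only [h2]
  rw [← Finset.mul_sum, sum_restrict, ← mul_assoc (2 ^ A.card), ← pow_add,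
    Nat.add_sub_cancel' hcard, ← mul_assoc, inv_mul_cancel₀ (by positivity), one_mul]

/-- On polynomials in boundedly many variables the pseudo-expectation is an expectation. -/
theorem pE_mul_eq_expect {μ : PMF (Fin k → ℤˣ)} {D : Finset (Fin I.m)}
    {𝒜 ℬ : Set (Finset (Fin n))}
    (h : ∀ A ∈ 𝒜, ∀ B ∈ ℬ,
      I.charExpectation μ (symmDiff A B) = I.expect μ D (signChar (symmDiff A B)))
    {p q : MvPolynomial (Fin n) ℝ} (hp : p ∈ Submodule.span ℝ (character '' 𝒜))
    (hq : q ∈ Submodule.span ℝ (character '' ℬ)) :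
    I.pE μ (p * q) = I.expect μ D fun x =>
      MvPolynomial.eval (fun i => ((x i : ℤ) : ℝ)) p *
        MvPolynomial.eval (fun i => ((x i : ℤ) : ℝ)) q := by
  induction hp, hq using Submodule.span_induction₂ with
  | mem_mem p q hp hq =>
    obtain ⟨A, hA, rfl⟩ := hp
    obtain ⟨B, hB, rfl⟩ := hq
    rw [pE_character_mul, h A hA B hB]
    simp only [eval_character, signChar_mul]
  | zero_left => simp [expect]
  | zero_right => simp [expect]
  | add_left p p' q _ _ _ h₁ h₂ =>
    rw [add_mul, map_add, h₁, h₂]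
    simp only [expect, map_add, add_mul, mul_add, Finset.sum_add_distrib]
  | add_right p q q' _ _ _ h₁ h₂ =>
    rw [mul_add, map_add, h₁, h₂]
    simp only [expect, map_add, mul_add, Finset.sum_add_distrib]
  | smul_left a p q _ _ h₁ =>
    rw [smul_mul_assoc, map_smul, h₁]
    simp only [expect, MvPolynomial.smul_eval, smul_eq_mul, Finset.mul_sum]
    exact Finset.sum_congr rfl fun x _ => by ring
  | smul_right a p q _ _ h₁ =>
    rw [mul_smul_comm, map_smul, h₁]
    simp only [expect, MvPolynomial.smul_eval, smul_eq_mul, Finset.mul_sum]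
    exact Finset.sum_congr rfl fun x _ => by ring

theorem expect_sq_nonneg (μ : PMF (Fin k → ℤˣ)) (D : Finset (Fin I.m))
    (f : (Fin n → ℤˣ) → ℝ) : 0 ≤ I.expect μ D fun x => f x * f x :=
  mul_nonneg (by positivity)
    (Finset.sum_nonneg fun x _ => mul_nonneg (I.density_nonneg μ D x) (mul_self_nonneg _))

/-- Conditioning on the variables in `V`: a function `h` on `V` is orthogonal to `χ_T` as soon
as it is orthogonal to all characters on `V` occurring in the conditional expectation of `χ_T`. -/
theorem expect_mul_signChar_eq_zero {μ : PMF (Fin k → ℤˣ)} {V T : Finset (Fin n)}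
    {D : Finset (Fin I.m)} (hD : Disjoint (I.clausesIn V) D) {h : (Fin n → ℤˣ) → ℝ}
    (hh : ∀ v ∉ V, ∀ x, h (flipSign v x) = h x)
    (hB : ∀ B ⊆ V, I.expect μ D (signChar (symmDiff T B)) ≠ 0 →
      I.expect μ (I.clausesIn V) (fun x => h x * signChar B x) = 0) :
    I.expect μ (I.clausesIn V ∪ D) (fun x => h x * signChar T x) = 0 := by
  classical
  -- Fourier inversion is applied only to the factor `χ_T` times the density of `D`.
  have hsplit : ∀ x, 2 ^ n * (I.density μ (I.clausesIn V ∪ D) x * (h x * signChar T x)) =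
      ∑ B : Finset (Fin n), (∑ y, I.density μ D y * signChar (symmDiff T B) y) *
        (I.density μ (I.clausesIn V) x * (h x * signChar B x)) := by
    intro x
    have h1 := two_pow_mul_eq_sum_signChar (fun y => I.density μ D y * signChar T y) x
    rw [Fintype.card_fin] at h1
    have h2 : I.density μ (I.clausesIn V ∪ D) x =
        I.density μ (I.clausesIn V) x * I.density μ D x := Finset.prod_union hD
    rw [h2, show 2 ^ n * (I.density μ (I.clausesIn V) x * I.density μ D x *
      (h x * signChar T x)) = I.density μ (I.clausesIn V) x * h x *
      (2 ^ n * (I.density μ D x * signChar T x)) by ring, h1, Finset.mul_sum]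
    refine Finset.sum_congr rfl fun B _ => ?_
    simp only [mul_assoc, signChar_mul]
    ring
  have hzero : ∑ x, 2 ^ n * (I.density μ (I.clausesIn V ∪ D) x * (h x * signChar T x)) = 0 := by
    simp only [hsplit]
    rw [Finset.sum_comm]
    refine Finset.sum_eq_zero fun B _ => ?_
    rw [← Finset.mul_sum, mul_eq_zero]
    by_cases hBV : B ⊆ V
    · by_cases hne : I.expect μ D (signChar (symmDiff T B)) = 0
      · left
        simpa [expect] using hne
      · right
        simpa [expect] using hB B hBV hne
    -- A variable of `B` outside `V` occurs nowhere else in the integrand, so flipping it kills the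
    -- sum.
    · right
      obtain ⟨v, hvB, hvV⟩ := Finset.not_subset.mp hBV
      refine sum_eq_zero_of_flipSign v fun x => ?_
      have hvD : v ∉ (I.clausesIn V).biUnion I.verts := fun hv => by
        obtain ⟨c, hc, hvc⟩ := Finset.mem_biUnion.mp hv
        exact hvV (I.mem_clausesIn.mp hc hvc)
      rw [I.density_flipSign μ hvD, hh v hvV, signChar_flipSign_of_mem hvB]
      ring
  rw [← Finset.mul_sum] at hzero
  rw [expect, (mul_eq_zero.mp hzero).resolve_left (by positivity), mul_zero]

end CSPInstance

/-! ### Enumeration by size and numerical bounds -/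

/-- The subsets of `Fin n` can be listed in order of their size. -/
theorem exists_rank_card_mono (n : ℕ) : ∃ r : Finset (Fin n) → ℕ, Function.Injective r ∧
    ∀ A B, r A < r B → A.card ≤ B.card := by
  classical
  let o := Fintype.equivFin (Finset (Fin n))
  set K := Fintype.card (Finset (Fin n)) with hK
  -- Lexicographic order: size first, then an arbitrary numbering below `K`.
  refine ⟨fun A => A.card * K + o A, fun A B h => ?_, fun A B h => ?_⟩
  · have h1 : (o A : ℕ) = o B := by
      have := congrArg (· % K) h
      simpa [Nat.mod_eq_of_lt (o A).2, Nat.mod_eq_of_lt (o B).2] using this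
    exact o.injective (Fin.ext h1)
  · by_contra! hlt
    have hB := (o B).2
    have : (B.card + 1) * K ≤ A.card * K := Nat.mul_le_mul_right _ hlt
    dsimp only at h
    rw [add_mul, one_mul] at this
    omega

theorem card_subtype_card_le (n N : ℕ) : Fintype.card {A : Finset (Fin n) // A.card ≤ N} =
    ∑ j ∈ Finset.range (N + 1), n.choose j := by
  classical
  rw [Fintype.card_subtype, Finset.card_eq_sum_card_fiberwise (f := Finset.card)
    (t := Finset.range (N + 1)) (by intro A hA; simp at hA ⊢; omega)]
  refine Finset.sum_congr rfl fun j hj => ?_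
  rw [Finset.mem_range] at hj
  have : ((Finset.univ.filter fun A : Finset (Fin n) => A.card ≤ N).filter fun A => A.card = j) =
      Finset.powersetCard j Finset.univ := by
    ext A
    simp [Finset.mem_powersetCard]
    omega
  rw [this, Finset.card_powersetCard, Finset.card_fin]

theorem multilinearPolys_eq_span_range {n : ℕ} {d : ℝ} (hd : 0 ≤ d) : multilinearPolys n d =
    Submodule.span ℝ (Set.range fun A : {A : Finset (Fin n) // A.card ≤ ⌊d⌋₊} =>
      character A.1) := by
  unfold multilinearPolys
  congr 1
  ext p
  constructor
  · rintro ⟨A, hA, rfl⟩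
    exact ⟨⟨A, Nat.le_floor hA⟩, rfl⟩
  · rintro ⟨A, rfl⟩
    exact ⟨A.1, (Nat.le_floor_iff hd).mp A.2, rfl⟩

theorem sosEta_nonneg (γ : ℝ) : 0 ≤ sosEta γ :=
  Real.rpow_nonneg (by positivity) _

theorem sosDegree_nonneg (k n : ℕ) (γ : ℝ) : 0 ≤ sosDegree k n γ := by
  have := sosEta_nonneg γ
  unfold sosDegree
  positivity

/-- If the degree bound is not trivial, then the girth exceeds `3`. -/
theorem three_lt_girth {k n : ℕ} (hk : 2 ≤ k) {γ : ℝ} (hγ : Real.exp k * (k : ℝ) ^ 2 ≤ γ)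
    (hd : 1 ≤ sosDegree k n γ) : 3 < girthTau k γ * Real.logb 2 n := by
  have hk2 : (2 : ℝ) ≤ k := by exact_mod_cast hk
  have hexp : 1 ≤ Real.exp k := Real.one_le_exp (by positivity)
  have hkγ : (k : ℝ) ^ 2 ≤ γ := le_trans (by nlinarith [sq_nonneg (k : ℝ)]) hγ
  have hγ4 : 4 ≤ γ := by nlinarith
  have hγ0 : 0 < γ := by linarith
  have hη : sosEta γ = (γ ^ 800)⁻¹ := by
    rw [sosEta, expansionDelta, show (2 / (1 / 200) : ℝ) = (400 : ℕ) by norm_num,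
      Real.rpow_natCast, one_div, inv_pow, ← pow_mul]
  have hn : γ ^ 800 ≤ n := by
    rw [sosDegree, hη, le_div_iff₀ (by positivity), one_mul, inv_mul_eq_div,
      le_div_iff₀ (by positivity)] at hd
    nlinarith [pow_pos hγ0 800]
  have hlog : 800 * Real.logb 2 γ ≤ Real.logb 2 n := by
    have := Real.logb_le_logb_of_le one_lt_two (pow_pos hγ0 800) hn
    rwa [Real.logb_pow, Nat.cast_ofNat] at this
  have hlogγ : 0 < Real.logb 2 γ := Real.logb_pos one_lt_two (by linarith)
  have hlogk : Real.logb 2 (γ * (k : ℝ) ^ 2) ≤ 2 * Real.logb 2 γ := by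
    rw [Real.logb_mul (by positivity) (by positivity), two_mul]
    gcongr
    exact one_lt_two
  have hlogk0 : 0 < Real.logb 2 (γ * (k : ℝ) ^ 2) :=
    Real.logb_pos one_lt_two (by nlinarith)
  -- Since `n ≥ γ^800` and `k² ≤ γ`, the girth bound is at least `800 log γ / (8 log γ) = 100`.
  rw [girthTau, one_div, inv_mul_eq_div, lt_div_iff₀ (by positivity)]
  linarith

/-! ### Local projections and the orthogonal basis -/

namespace CSPInstance

variable {k n : ℕ} (I : CSPInstance k n)

/-- One step of the Gram–Schmidt process inside a family on which the pseudo-expectation is an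
expectation. -/
theorem exists_local_projection {μ : PMF (Fin k → ℤˣ)} {D : Finset (Fin I.m)}
    {S : Finset (Fin n)} {𝒥 : Set (Finset (Fin n))}
    (h : ∀ A ∈ insert S 𝒥, ∀ B ∈ insert S 𝒥,
      I.charExpectation μ (symmDiff A B) = I.expect μ D (signChar (symmDiff A B))) :
    ∃ g ∈ Submodule.span ℝ (character '' insert S 𝒥),
      character S - g ∈ Submodule.span ℝ (character '' 𝒥) ∧ 0 ≤ I.pE μ (g ^ 2) ∧
      ∀ B ∈ 𝒥, I.expect μ D (fun x =>
        MvPolynomial.eval (fun i => ((x i : ℤ) : ℝ)) g * signChar B x) = 0 := by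
  classical
  obtain ⟨a, ha⟩ := exists_weighted_projection (I.density_nonneg μ D)
    (fun B : 𝒥 => signChar B.1) (signChar S)
  have hsum : ∑ B : 𝒥, a B • character B.1 ∈ Submodule.span ℝ (character '' 𝒥) :=
    Submodule.sum_mem _ fun B _ => Submodule.smul_mem _ _ (Submodule.subset_span ⟨B.1, B.2, rfl⟩)
  have hg : character S - ∑ B : 𝒥, a B • character B.1 ∈
      Submodule.span ℝ (character '' insert S 𝒥) :=
    Submodule.sub_mem _ (Submodule.subset_span ⟨S, Set.mem_insert _ _, rfl⟩)
      (Submodule.span_mono (Set.image_mono (Set.subset_insert _ _)) hsum)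
  refine ⟨_, hg, by rwa [sub_sub_cancel], ?_, fun B hB => ?_⟩
  · rw [sq, I.pE_mul_eq_expect h hg hg]
    exact I.expect_sq_nonneg μ D _
  · simp only [expect, map_sub, map_sum, MvPolynomial.smul_eval, eval_character]
    exact mul_eq_zero_of_right _ (ha ⟨B, hB⟩)

theorem eval_flipSign_of_mem_span {V : Finset (Fin n)} {𝒜 : Set (Finset (Fin n))}
    (h𝒜 : ∀ A ∈ 𝒜, A ⊆ V) {p : MvPolynomial (Fin n) ℝ}
    (hp : p ∈ Submodule.span ℝ (character '' 𝒜)) {v : Fin n} (hv : v ∉ V) (x : Fin n → ℤˣ) :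
    MvPolynomial.eval (fun i => ((flipSign v x i : ℤ) : ℝ)) p =
      MvPolynomial.eval (fun i => ((x i : ℤ) : ℝ)) p := by
  induction hp using Submodule.span_induction with
  | mem p hp =>
    obtain ⟨A, hA, rfl⟩ := hp
    rw [eval_character, eval_character, signChar_flipSign_of_notMem fun h => hv (h𝒜 A hA h)]
  | zero => simp
  | add p q _ _ hp hq => rw [map_add, map_add, hp, hq]
  | smul a p _ hp => rw [MvPolynomial.smul_eval, MvPolynomial.smul_eval, hp]

/-- If each character can be orthogonalised against the preceding ones, then there is an
orthogonal basis of polynomials with nonnegative squares. -/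
theorem exists_orthogonal_basis {μ : PMF (Fin k → ℤˣ)} {r : Finset (Fin n) → ℕ}
    (hr : Function.Injective r) (hrc : ∀ A B, r A < r B → A.card ≤ B.card) {d : ℝ} (hd : 0 ≤ d)
    (h : ∀ S : Finset (Fin n), S.card ≤ ⌊d⌋₊ → ∃ g,
      character S - g ∈ Submodule.span ℝ (character '' {B | r B < r S}) ∧
      0 ≤ I.pE μ (g ^ 2) ∧ ∀ T, r T < r S → I.pE μ (g * character T) = 0) :
    (∃ χ : Fin (∑ j ∈ Finset.range (⌊d⌋₊ + 1), n.choose j) → MvPolynomial (Fin n) ℝ,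
      Submodule.span ℝ (Set.range χ) = multilinearPolys n d ∧
      (∀ i, 0 ≤ I.pE μ (χ i ^ 2)) ∧
      (∀ i j, i ≠ j → I.pE μ (χ i * χ j) = 0)) ∧
    (∀ f ∈ multilinearPolys n d, 0 ≤ I.pE μ (f ^ 2)) := by
  classical
  obtain ⟨c⟩ : Nonempty (Fin (∑ j ∈ Finset.range (⌊d⌋₊ + 1), n.choose j) ≃
      {A : Finset (Fin n) // A.card ≤ ⌊d⌋₊}) :=
    ⟨(Fintype.equivFinOfCardEq (card_subtype_card_le n _)).symm⟩
  rw [multilinearPolys_eq_span_range hd, ← c.surjective.range_comp]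
  generalize (∑ j ∈ Finset.range (⌊d⌋₊ + 1), n.choose j) = M at c ⊢
  choose g hg hg2 hgo using fun i => h (c i).1 (c i).2
  set e : Fin M → MvPolynomial (Fin n) ℝ := fun i => character (c i).1 with he
  have htri : ∀ i, e i - g i ∈ Submodule.span ℝ (e '' {j | r (c j).1 < r (c i).1}) := by
    intro i
    refine Submodule.span_mono ?_ (hg i)
    rintro _ ⟨B, hB, rfl⟩
    refine ⟨c.symm ⟨B, (hrc B _ hB).trans (c i).2⟩, ?_, ?_⟩
    · simpa using hB
    · simp [he]
  have hspan := span_range_eq_of_triangular (e := e) (g := g) (r := fun i => r (c i).1) htri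
  have horth : ∀ i j, i ≠ j → I.pE μ (g i * g j) = 0 := fun i j hij =>
    orthogonal_of_triangular (L := I.pE μ) (e := e) (g := g) (r := fun i => r (c i).1)
      (hr.comp (Subtype.val_injective.comp c.injective)) htri
      (fun i j hji => hgo i (c j).1 hji) hij
  exact ⟨⟨g, hspan, hg2, horth⟩, fun f hf =>
    sq_nonneg_of_orthogonal (L := I.pE μ) hg2 horth (hspan.symm ▸ hf)⟩

/-- For unary clauses the pseudo-expectation is the expectation of a product measure. -/
theorem charExpectation_eq_expect_univ {I : CSPInstance 1 n} (μ : PMF (Fin 1 → ℤˣ))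
    (S : Finset (Fin n)) :
    I.charExpectation μ S = I.expect μ Finset.univ (signChar S) := by
  classical
  rw [charExpectation_eq_expect]
  have hverts : ∀ c j, I.verts c = {I.var c j} := fun c j => by
    ext v
    simp [verts, Subsingleton.elim j 0]
  have key : ∀ G : Finset (Fin I.m), Disjoint G (I.clausesIn (I.cl S)) →
      I.expect μ (G ∪ I.clausesIn (I.cl S)) (signChar S) =
        I.expect μ (I.clausesIn (I.cl S)) (signChar S) := by
    intro G
    induction G using Finset.induction_on with
    | empty => simp
    | insert c G hcG ih =>
      intro hdis
      rw [Finset.disjoint_insert_left] at hdis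
      rw [Finset.insert_union, expect_insert, ih hdis.2]
      · simp [hcG, hdis.1]
      -- Distinct unary clauses have distinct variables, and one outside the closure avoids `S`; so
      -- its variable is free.
      · rintro T ⟨j, hj⟩
        refine Or.inr ⟨j, hj, fun hmem => ?_⟩
        rcases Finset.mem_union.mp hmem with hS | hD
        · refine hdis.1 (I.mem_clausesIn.mpr ?_)
          rw [hverts c j, Finset.singleton_subset_iff]
          exact I.subset_cl S hS
        · obtain ⟨d, hd, hcd⟩ := Finset.mem_biUnion.mp hD
          have hdc : d = c := I.distinct (by
            change I.verts d = I.verts c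
            rw [hverts d j, Finset.mem_singleton] at hcd
            rw [hverts d j, hverts c j, hcd])
          rw [hdc, Finset.mem_union] at hd
          exact hd.elim hcG hdis.1
  rw [← key _ Finset.sdiff_disjoint, Finset.sdiff_union_of_subset (Finset.subset_univ _)]

end CSPInstance

theorem mainTheorem3 (k n : ℕ) (hk : 1 ≤ k) (γ : ℝ) (hγ : Real.exp k * (k : ℝ) ^ 2 ≤ γ)
    (I : CSPInstance k n) (hI : I.IsNice γ)
    (μ : PMF (Fin k → ℤˣ)) (hμ : PairwiseIndependent μ) :
    (∃ χ : Fin (∑ j ∈ Finset.range (⌊sosDegree k n γ⌋₊ + 1), n.choose j) →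
        MvPolynomial (Fin n) ℝ,
      Submodule.span ℝ (Set.range χ) = multilinearPolys n (sosDegree k n γ) ∧
      (∀ i, 0 ≤ I.pE μ (χ i ^ 2)) ∧
      (∀ i j, i ≠ j → I.pE μ (χ i * χ j) = 0)) ∧
    (∀ f ∈ multilinearPolys n (sosDegree k n γ), 0 ≤ I.pE μ (f ^ 2)) := by
  classical
  have hd0 := sosDegree_nonneg k n γ
  obtain ⟨r, hr, hrc⟩ := exists_rank_card_mono n
  refine I.exists_orthogonal_basis hr hrc hd0 fun S hS => ?_
  -- For `k = 1` pairwise independence says nothing, but `pE` is the expectation of a product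
  -- measure and ordinary Gram–Schmidt applies.
  rcases hk.eq_or_lt with rfl | hk2
  · have hE : ∀ A B : Finset (Fin n), I.charExpectation μ (symmDiff A B) =
        I.expect μ Finset.univ (signChar (symmDiff A B)) := fun A B =>
      CSPInstance.charExpectation_eq_expect_univ μ _
    obtain ⟨g, hg, hSg, hg2, hgo⟩ := I.exists_local_projection (S := S) (𝒥 := {B | r B < r S})
      fun A _ B _ => hE A B
    refine ⟨g, hSg, hg2, fun T hT => ?_⟩
    rw [I.pE_mul_eq_expect (ℬ := {T}) (fun A _ B _ => hE A B) hg
      (Submodule.subset_span ⟨T, rfl, rfl⟩)]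
    simp only [eval_character]
    exact hgo T hT
  rcases lt_or_ge (sosDegree k n γ) 1 with hd | hd
  -- Below degree 1 only the constant character remains, and the girth bound is not needed.
  · rw [Nat.floor_eq_zero.mpr hd, Nat.le_zero, Finset.card_eq_zero] at hS
    subst hS
    refine ⟨character ∅, by simp, ?_, fun T hT => ?_⟩
    · rw [sq, I.pE_character_mul, symmDiff_self, Finset.bot_eq_empty, I.charExpectation_eq_expect]
      have h1 : signChar (∅ : Finset (Fin n)) = fun _ => (1 : ℝ) * 1 := by
        ext
        simp [signChar]
      rw [h1]
      exact I.expect_sq_nonneg μ _ fun _ => 1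
    · have := hrc _ _ hT
      rw [Finset.card_empty, Nat.le_zero, Finset.card_eq_zero] at this
      rw [this] at hT
      exact absurd hT (lt_irrefl _)
  obtain ⟨hexp, hgirth⟩ := hI
  have hg3 := three_lt_girth hk2 hγ hd
  have hsize : ∀ U : Finset (Fin n), U.card ≤ 2 * ⌊sosDegree k n γ⌋₊ →
      ((I.clausesIn (I.rClosure 5 U)).card : ℝ) ≤ sosEta γ * n := by
    intro U hU
    refine hexp.card_clausesIn_rClosure hk2 ?_
    have hU' : (U.card : ℝ) ≤ 2 * ⌊sosDegree k n γ⌋₊ := by exact_mod_cast hU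
    have hfl := Nat.floor_le hd0
    have hkR : (2 : ℝ) ≤ k := by exact_mod_cast hk2
    have hηn : sosEta γ * n = 10000 * k * sosDegree k n γ := by
      rw [sosDegree]
      field_simp
    rw [hηn]
    nlinarith
  -- A 5-closed set is 3-closed, so it contains `cl A`; consistency then transfers the expectation
  -- from `cl A` to the larger set.
  have hconsist : ∀ U : Finset (Fin n), U.card ≤ 2 * ⌊sosDegree k n γ⌋₊ →
      ∀ A ⊆ I.rClosure 5 U, I.charExpectation μ A =
        I.expect μ (I.clausesIn (I.rClosure 5 U)) (signChar A) := by
    intro U hU A hA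
    rw [I.charExpectation_eq_expect]
    exact (hexp.expect_eq_of_isRClosed hk2 hμ hgirth hg3 (I.isRClosed_rClosure 3 A)
      (I.subset_rClosure 3 A) (I.clausesIn_mono
        (((I.isRClosed_rClosure 5 U).of_le (by norm_num)).rClosure_subset hA)) (hsize U hU)).symm
  have hsymm : ∀ {A B V : Finset (Fin n)}, A ⊆ V → B ⊆ V → symmDiff A B ⊆ V := fun hA hB =>
    (symmDiff_le_sup (a := _) (b := _)).trans (Finset.union_subset hA hB)
  set V := I.rClosure 5 S with hV
  have hVc : I.IsRClosed 5 V := I.isRClosed_rClosure 5 S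
  have hSV : S ⊆ V := I.subset_rClosure 5 S
  have hJV : ∀ A ∈ insert S {B | B ⊆ V ∧ r B < r S}, A ⊆ V := by
    rintro A (rfl | hA)
    · exact hSV
    · exact hA.1
  have hloc : ∀ A ∈ insert S {B | B ⊆ V ∧ r B < r S}, ∀ B ∈ insert S {B | B ⊆ V ∧ r B < r S},
      I.charExpectation μ (symmDiff A B) =
        I.expect μ (I.clausesIn V) (signChar (symmDiff A B)) := fun A hA B hB =>
    hconsist S (by omega) _ (hsymm (hJV A hA) (hJV B hB))
  obtain ⟨g, hg, hSg, hg2, hgo⟩ := I.exists_local_projection hloc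
  refine ⟨g, Submodule.span_mono (Set.image_mono fun B hB => hB.2) hSg, hg2, fun T hT => ?_⟩
  have hTS := hrc T S hT
  have hcard : (S ∪ T).card ≤ 2 * ⌊sosDegree k n γ⌋₊ :=
    (Finset.card_union_le S T).trans (by omega)
  set U := I.rClosure 5 (S ∪ T) with hU
  have hVU : V ⊆ U := (I.isRClosed_rClosure 5 _).rClosure_subset
    (Finset.subset_union_left.trans (I.subset_rClosure 5 _))
  have hTU : T ⊆ U := Finset.subset_union_right.trans (I.subset_rClosure 5 _)
  by_cases hTV : T ⊆ V
  · rw [I.pE_mul_eq_expect (ℬ := {T}) (D := I.clausesIn V) ?_ hg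
      (Submodule.subset_span ⟨T, rfl, rfl⟩)]
    · simp only [eval_character]
      exact hgo T ⟨hTV, hT⟩
    · rintro A hA B rfl
      exact hloc A hA B (Or.inr ⟨hTV, hT⟩)
  · rw [I.pE_mul_eq_expect (ℬ := {T}) (D := I.clausesIn U) ?_ hg
      (Submodule.subset_span ⟨T, rfl, rfl⟩)]
    · simp only [eval_character]
      rw [← Finset.union_sdiff_of_subset (I.clausesIn_mono hVU)]
      refine I.expect_mul_signChar_eq_zero Finset.disjoint_sdiff
        (fun v hv x => CSPInstance.eval_flipSign_of_mem_span hJV hg hv x) fun B hBV hne => hgo B ⟨hBV, ?_⟩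
      -- Here `|B| < |T| ≤ |S|`, and the ranking by size puts `B` before `S`.
      have hlt := hexp.card_lt_of_expect_ne_zero hk2 hμ hgirth hg3 hVc hBV hTV
        Finset.sdiff_disjoint (le_trans (by
          exact_mod_cast Finset.card_le_card Finset.sdiff_subset) (hsize _ hcard)) hne
      by_contra! hle
      rcases hle.eq_or_lt with h | h
      · rw [hr h] at hTS
        omega
      · have := hrc _ _ h
        omega
    · rintro A hA B rfl
      exact hconsist _ hcard _ (hsymm ((hJV A hA).trans hVU) hTU)
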